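/- **Notation.** Let $\mathbb H$ be the skew field of real quaternions, with Lebesgue measure $\mu$, and let $\theta\in[0,2\pi)$. Put $(\psi_0,\psi_1,\psi_2,\psi_3)=(1,\,i,\,ie^{i\theta}j,\,e^{i\theta}j)$. This is an orthonormal basis of $\mathbb H$; the real coordinates $x_k$ of $x\in\mathbb H$ are taken in it, $x=\sum_k x_k\psi_k$, and $\langle x,y\rangle_\theta=\sum_{k=0}^3x_ky_k$. Let $${}^\theta\mathcal D=\sum_{k=0}^3\psi_k\frac{\partial}{\partial x_k}.$$ For an open set $\Omega\subset\mathbb H$ and $\delta:\Omega\to\mathbb H$ let ${}^\theta_\delta\mathfrak M(\Omega)$ be the right quaternionic space of all $f\in C^1(\Omega,\mathbb H)$ with ${}^\theta\mathcal D[f]+\delta f=0$ on $\Omega$. Let $T(z)=(az+b)(cz+d)^{-1}$ with $a,b,c,d\in\mathbb H$, where $ad\ne0$ if $c=0$, and $b-ac^{-1}d\neq0$ if $c\ne0$. If $c=0$, put $$A_T=\bar d,\qquad B_T=\bar a,\qquad C_T=\frac{|a|^2}{|d|}d^{-1},\qquad \rho_T=1.$$ If $c\ne0$, put $e=b-ac^{-1}d$,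 $w(z)=cze^{-1}+de^{-1}$ and $$A_T(z)=\bar e\,\frac{\overline{w(z)}}{|w(z)|^4},\quad B_T(\zeta)=-\bar c\;\overline{(\zeta-ac^{-1})}\,|\zeta-ac^{-1}|^4,\quad C_T(z)=\frac{|c|^2}{|e|}\,e^{-1}\frac{\overline{w(z)}}{|w(z)|^4},\quad \rho_T(z)=\frac1{|w(z)|^2}.$$ A Bergman kernel of a space $A$ of $\mathbb H$-valued functions on $\Omega$ with inner product $\langle f,g\rangle=\int_\Omega\bar f g\,\gamma\,d\mu$ is a function $\mathcal B:\Omega\times\Omega\to\mathbb H$ such that, for every $z\in\Omega$, $\overline{\mathcal B(z,\cdot)}\in A$ and $f(z)=\int_\Omega \mathcal B(z,\zeta)f(\zeta)\gamma(\zeta)\,d\mu_\zeta$ for all $f\in A$. The corresponding Bergman projection is $\mathfrak B[f](z)=\int_\Omega \mathcal B(z,\zeta)f(\zeta)\gamma(\zeta)\,d\mu_\zeta$ for $f\in\mathcal L_{2,\gamma}(\Omega,\mathbb H)$. **Proposition.** Let $u,v\in\mathbb H$, and let $\Omega,\Xi\subset\mathbb H$ be domains with $cz+d\ne0$ for all $z\in\Xi$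 and $T(\Xi)=\Omega$. Put $$\delta_T(\zeta)=B_T(\zeta)^{-1}\,v\,A_T(T^{-1}(\zeta))\quad(\zeta\in\Omega),\qquad \gamma_T(z)=e^{-2\langle v-u,z\rangle_\theta}\rho_T(z)\quad(z\in\Xi).$$ Let ${}^\theta_{\delta_T}\mathcal A(\Omega)={}^\theta_{\delta_T}\mathfrak M(\Omega)\cap\mathcal L_2(\Omega,\mathbb H)$ with inner product $\int_\Omega\bar fg\,d\mu$, and ${}^\theta_u\mathcal A_{\gamma_T}(\Xi)={}^\theta_u\mathfrak M(\Xi)\cap\mathcal L_{2,\gamma_T}(\Xi,\mathbb H)$ with inner product $\int_\Xi\bar fg\,\gamma_T\,d\mu$. Let $U$ be the operator $$U[f](z)=e^{\langle v-u,z\rangle_\theta}\,C_T(z)\,f(T(z))\qquad(z\in\Xi).$$ 1. ${}^\theta_{\delta_T}\mathcal A(\Omega)$ and ${}^\theta_u\mathcal A_{\gamma_T}(\Xi)$ are quaternionic right Hilbert spaces on which every evaluation functional $f\mapsto f(z)$ is bounded, and each has exactly one Bergman kernel. These are denoted ${}^\theta_{\delta_T}\mathcal B_\Omega$ and ${}^\theta_u\mathcal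 B_{\Xi,\gamma_T}$, and their projections ${}^\theta_{\delta_T}\mathfrak B_\Omega$ and ${}^\theta_u\mathfrak B_{\Xi,\gamma_T}$. 2. $U$ restricts to an isometric isomorphism of quaternionic right Hilbert spaces from ${}^\theta_{\delta_T}\mathcal A(\Omega)$ onto ${}^\theta_u\mathcal A_{\gamma_T}(\Xi)$. 3. For all $z,w\in\Xi$, $${}^\theta_u\mathcal B_{\Xi,\gamma_T}(z,w)=e^{\langle v-u,z+w\rangle_\theta}\,C_T(z)\;{}^\theta_{\delta_T}\mathcal B_\Omega(T(z),T(w))\;\overline{C_T(w)}.$$ 4. $U$ is a right linear bijection from $\mathcal L_2(\Omega,\mathbb H)$ onto $\mathcal L_{2,\gamma_T}(\Xi,\mathbb H)$, and on $\mathcal L_{2,\gamma_T}(\Xi,\mathbb H)$ $${}^\theta_u\mathfrak B_{\Xi,\gamma_T}=U\circ{}^\theta_{\delta_T}\mathfrak B_\Omega\circ U^{-1}.$$ -/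

import Mathlib

open scoped Quaternion

namespace HyperBergman

noncomputable section

/-! ### Volume on the quaternions -/

instance : MeasurableSpace ℍ[ℝ] := borel ℍ[ℝ]

instance : BorelSpace ℍ[ℝ] := ⟨rfl⟩

/-! ### The structural set and the operator of Cauchy-Riemann type

A point of a domain is the quaternion `z = x₀ + x₁ i + x₂ i e^{iθ} j + x₃ e^{iθ} j`, and
`x₀, x₁, x₂, x₃` are its real coordinates. -/

/-- The imaginary unit `i`. -/
def qi : ℍ[ℝ] := ⟨0, 1, 0, 0⟩

/-- The imaginary unit `j`. -/
def qj : ℍ[ℝ] := ⟨0, 0, 1, 0⟩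

/-- The quaternion `e^{iθ} = cos θ + i sin θ`. -/
def qexp (θ : ℝ) : ℍ[ℝ] := ⟨Real.cos θ, Real.sin θ, 0, 0⟩

/-- The structural set `(1, i, i e^{iθ} j, e^{iθ} j)`. -/
def psi (θ : ℝ) : Fin 4 → ℍ[ℝ] := ![1, qi, qi * qexp θ * qj, qexp θ * qj]

/-- The coordinates of a quaternion in the basis `psi θ`. -/
def coord (θ : ℝ) (z : ℍ[ℝ]) : Fin 4 → ℝ :=
  ![z.re, z.imI, -Real.sin θ * z.imJ + Real.cos θ * z.imK,
    Real.cos θ * z.imJ + Real.sin θ * z.imK]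

theorem psi_eq (θ : ℝ) : psi θ = ![1, ⟨0, 1, 0, 0⟩, ⟨0, 0, -Real.sin θ, Real.cos θ⟩,
    ⟨0, 0, Real.cos θ, Real.sin θ⟩] := by
  have i0 : qi.re = 0 := rfl
  have i1 : qi.imI = 1 := rfl
  have i2 : qi.imJ = 0 := rfl
  have i3 : qi.imK = 0 := rfl
  have j0 : qj.re = 0 := rfl
  have j1 : qj.imI = 0 := rfl
  have j2 : qj.imJ = 1 := rfl
  have j3 : qj.imK = 0 := rfl
  have e0 : (qexp θ).re = Real.cos θ := rfl
  have e1 : (qexp θ).imI = Real.sin θ := rfl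
  have e2 : (qexp θ).imJ = 0 := rfl
  have e3 : (qexp θ).imK = 0 := rfl
  have h2 : qi * qexp θ * qj = ⟨0, 0, -Real.sin θ, Real.cos θ⟩ := by
    ext <;> simp [i0, i1, i2, i3, j0, j1, j2, j3, e0, e1, e2, e3]
  have h3 : qexp θ * qj = ⟨0, 0, Real.cos θ, Real.sin θ⟩ := by
    ext <;> simp [j0, j1, j2, j3, e0, e1, e2, e3]
  rw [psi, h2, h3, qi]

theorem sum_smul_psi (θ : ℝ) (x : Fin 4 → ℝ) : ∑ k, x k • psi θ k =
    ⟨x 0, x 1, -Real.sin θ * x 2 + Real.cos θ * x 3, Real.cos θ * x 2 + Real.sin θ * x 3⟩ := by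
  simp only [Fin.sum_univ_four, psi_eq]
  ext
  · change x 0 * 1 + x 1 * 0 + x 2 * 0 + x 3 * 0 = x 0
    ring
  · change x 0 * 0 + x 1 * 1 + x 2 * 0 + x 3 * 0 = x 1
    ring
  · change x 0 * 0 + x 1 * 0 + x 2 * -Real.sin θ + x 3 * Real.cos θ
      = -Real.sin θ * x 2 + Real.cos θ * x 3
    ring
  · change x 0 * 0 + x 1 * 0 + x 2 * Real.cos θ + x 3 * Real.sin θ
      = Real.cos θ * x 2 + Real.sin θ * x 3
    ring

theorem sum_coord_smul_psi (θ : ℝ) (z : ℍ[ℝ]) : ∑ k, coord θ z k • psi θ k = z := by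
  have h := Real.sin_sq_add_cos_sq θ
  rw [sum_smul_psi]
  ext
  · simp [coord]
  · simp [coord]
  · simp [coord]
    linear_combination z.imJ * h
  · simp [coord]
    linear_combination z.imK * h

theorem coord_sum_smul_psi (θ : ℝ) (x : Fin 4 → ℝ) : coord θ (∑ k, x k • psi θ k) = x := by
  have h := Real.sin_sq_add_cos_sq θ
  rw [sum_smul_psi]
  funext k
  fin_cases k
  · simp [coord]
  · simp [coord]
  · simp [coord]
    linear_combination x 2 * h
  · simp [coord]
    linear_combination x 3 * h

/-- `⟨x, y⟩_θ = ∑ x_k y_k`. -/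
def thetaInner (θ : ℝ) (x y : ℍ[ℝ]) : ℝ := ∑ k, coord θ x k * coord θ y k

/-- The left operator `∂/∂x₀ + i ∂/∂x₁ + i e^{iθ} j ∂/∂x₂ + e^{iθ} j ∂/∂x₃`; the partial derivative
`∂/∂x_k` is the derivative in the direction of the `k`-th basis vector. -/
def thetaD (θ : ℝ) (f : ℍ[ℝ] → ℍ[ℝ]) (z : ℍ[ℝ]) : ℍ[ℝ] :=
  ∑ k, psi θ k * fderiv ℝ f z (psi θ k)

/-! ### Function spaces

Functions on `Ω` are functions on the subtype. They form a right quaternionic space, that is, a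
module over the opposite ring: `(MulOpposite.op q • f) z = f z * q`. -/

/-- Extension by zero, used to differentiate at the points of an open set. -/
def zeroExt {Ω : Set ℍ[ℝ]} (f : Ω → ℍ[ℝ]) : ℍ[ℝ] → ℍ[ℝ] := Function.extend Subtype.val f 0

theorem zeroExt_add {Ω : Set ℍ[ℝ]} (f g : Ω → ℍ[ℝ]) :
    zeroExt (f + g) = zeroExt f + zeroExt g := by
  simpa [zeroExt] using
    (Function.extend_add (Subtype.val : Ω → ℍ[ℝ]) f g (0 : ℍ[ℝ] → ℍ[ℝ]) 0)

theorem zeroExt_smul {Ω : Set ℍ[ℝ]} (q : ℍ[ℝ]ᵐᵒᵖ) (f : Ω → ℍ[ℝ]) :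
    zeroExt (q • f) = q • zeroExt f := by
  simpa [zeroExt] using
    (Function.extend_smul q (Subtype.val : Ω → ℍ[ℝ]) f (0 : ℍ[ℝ] → ℍ[ℝ]))

/-- The right quaternionic space of the functions `f` of class `C¹` on the open set `Ω` with
`thetaD θ f + δ f = 0` on `Ω`. -/
def regular (θ : ℝ) (Ω : Set ℍ[ℝ]) (δ : ℍ[ℝ] → ℍ[ℝ]) : Submodule ℍ[ℝ]ᵐᵒᵖ (Ω → ℍ[ℝ]) where
  carrier := {f | ∀ z : Ω, ContDiffAt ℝ 1 (zeroExt f) z ∧ thetaD θ (zeroExt f) z + δ z * f z = 0}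
  zero_mem' := by
    intro z
    have h : zeroExt (0 : Ω → ℍ[ℝ]) = 0 := by
      funext y
      by_cases hy : ∃ a : Ω, a.1 = y
      · obtain ⟨a, rfl⟩ := hy
        simp [zeroExt]
      · simp [zeroExt, Function.extend_apply' _ _ _ hy]
    rw [h]
    refine ⟨contDiffAt_const, ?_⟩
    simp [thetaD]
  add_mem' := by
    intro f g hf hg z
    obtain ⟨hf1, hf2⟩ := hf z
    obtain ⟨hg1, hg2⟩ := hg z
    rw [zeroExt_add]
    refine ⟨hf1.add hg1, ?_⟩
    have h : fderiv ℝ (zeroExt f + zeroExt g) z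
        = fderiv ℝ (zeroExt f) z + fderiv ℝ (zeroExt g) z :=
      fderiv_add (hf1.differentiableAt one_ne_zero) (hg1.differentiableAt one_ne_zero)
    simp only [thetaD, h, add_apply, mul_add, Finset.sum_add_distrib,
      Pi.add_apply] at *
    rw [add_add_add_comm, hf2, hg2, add_zero]
  smul_mem' := by
    intro q f hf z
    obtain ⟨hf1, hf2⟩ := hf z
    rw [zeroExt_smul]
    have e : q • zeroExt f = fun y => zeroExt f y * q.unop := rfl
    have hd := hf1.differentiableAt one_ne_zero
    rw [e]
    refine ⟨hf1.mul contDiffAt_const, ?_⟩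
    have h : thetaD θ (fun y => zeroExt f y * q.unop) z = thetaD θ (zeroExt f) z * q.unop := by
      simp only [thetaD, Finset.sum_mul]
      refine Finset.sum_congr rfl fun k _ => ?_
      rw [fderiv_mul_const' hd]
      simp [mul_assoc]
    rw [h]
    have h2 : (q • f) z = f z * q.unop := rfl
    rw [h2, ← mul_assoc, ← add_mul, hf2, zero_mul]

/-- The square integrable functions with respect to a measure `μ` on `Ω`. -/
def sqIntegrable {Ω : Set ℍ[ℝ]} (μ : MeasureTheory.Measure Ω) :
    Submodule ℍ[ℝ]ᵐᵒᵖ (Ω → ℍ[ℝ]) where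
  carrier := {f | MeasureTheory.MemLp f 2 μ}
  zero_mem' := MeasureTheory.MemLp.zero
  add_mem' := fun hf hg => hf.add hg
  smul_mem' := fun q _ hf => hf.const_smul q

/-- The inner product `∫ conj(f) g dμ`. -/
def qinner {Ω : Set ℍ[ℝ]} (μ : MeasureTheory.Measure Ω) (f g : Ω → ℍ[ℝ]) : ℍ[ℝ] :=
  ∫ z, star (f z) * g z ∂μ

/-- The Bergman space: the functions in `regular θ Ω δ` that are square integrable for `μ`. -/
def bergman (θ : ℝ) {Ω : Set ℍ[ℝ]} (δ : ℍ[ℝ] → ℍ[ℝ]) (μ : MeasureTheory.Measure Ω) :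
    Submodule ℍ[ℝ]ᵐᵒᵖ (Ω → ℍ[ℝ]) :=
  regular θ Ω δ ⊓ sqIntegrable μ

/-- Lebesgue measure on `Ω`. -/
def vol (Ω : Set ℍ[ℝ]) : MeasureTheory.Measure Ω :=
  MeasureTheory.Measure.comap Subtype.val MeasureTheory.volume

/-- The measure `γ dμ` on `Ω`, for a nonnegative weight `γ`. -/
def weightedVol (Ω : Set ℍ[ℝ]) (γ : ℍ[ℝ] → ℝ) : MeasureTheory.Measure Ω :=
  (vol Ω).withDensity fun z => ENNReal.ofReal (γ z)

/-! ### Quaternionic right Hilbert spaces, kernels and projections -/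

/-- `ip` makes the right quaternionic space `E` a quaternionic right Hilbert space. -/
structure IsRightHilbert {E : Type*} [AddCommGroup E] [Module ℍ[ℝ]ᵐᵒᵖ E]
    (ip : E → E → ℍ[ℝ]) : Prop where
  add_right : ∀ f g h, ip f (g + h) = ip f g + ip f h
  smul_right : ∀ f g (q : ℍ[ℝ]), ip f (MulOpposite.op q • g) = ip f g * q
  conj_symm : ∀ f g, star (ip f g) = ip g f
  nonneg : ∀ f, 0 ≤ (ip f f).re
  definite : ∀ f, (ip f f).re = 0 → f = 0
  complete : ∀ s : ℕ → E,
    (∀ ε > 0, ∃ N, ∀ m ≥ N, ∀ n ≥ N, √(ip (s m - s n) (s m - s n)).re < ε) →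
    ∃ f, ∀ ε > 0, ∃ N, ∀ n ≥ N, √(ip (s n - f) (s n - f)).re < ε

/-- `K` is the Bergman kernel of the space `A` with the inner product `qinner μ`: for every `z`, the
function `B_z = conj(K(z, ·))` lies in `A` and represents the evaluation at `z`. -/
def IsBergmanKernel {Ω : Set ℍ[ℝ]} (μ : MeasureTheory.Measure Ω)
    (A : Submodule ℍ[ℝ]ᵐᵒᵖ (Ω → ℍ[ℝ])) (K : Ω → Ω → ℍ[ℝ]) : Prop :=
  ∀ z, (fun ζ => star (K z ζ)) ∈ A ∧ ∀ f ∈ A, f z = qinner μ (fun ζ => star (K z ζ)) f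

/-- The Bergman projection with kernel `K`: `f ↦ ∫ K(·, ζ) f(ζ) dμ(ζ)`. -/
def bergmanProjection {Ω : Set ℍ[ℝ]} (μ : MeasureTheory.Measure Ω) (K : Ω → Ω → ℍ[ℝ])
    (f : Ω → ℍ[ℝ]) : Ω → ℍ[ℝ] :=
  fun z => ∫ ζ, K z ζ * f ζ ∂μ

/-! ### Möbius maps -/

/-- The coefficients of a quaternionic fractional linear transformation. -/
structure Mobius where
  /-- coefficient -/
  a : ℍ[ℝ]
  /-- coefficient -/
  b : ℍ[ℝ]
  /-- coefficient -/
  c : ℍ[ℝ]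
  /-- coefficient -/
  d : ℍ[ℝ]
  affine_nondeg : c = 0 → a * d ≠ 0
  nondeg : c ≠ 0 → b - a * c⁻¹ * d ≠ 0

namespace Mobius

variable (T : Mobius)

/-- `T(z) = (a z + b)(c z + d)⁻¹`, where `c z + d ≠ 0`. -/
def map (z : ℍ[ℝ]) : ℍ[ℝ] := (T.a * z + T.b) * (T.c * z + T.d)⁻¹

/-- The quaternions that `T` does not send to infinity. -/
def finiteSet : Set ℍ[ℝ] := {z | T.c * z + T.d ≠ 0}

/-- The inverse mapping of `T`, on the image of `T.finiteSet`. -/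
def inv : ℍ[ℝ] → ℍ[ℝ] := Function.invFunOn T.map T.finiteSet

/-- `b - a c⁻¹ d`. -/
def e : ℍ[ℝ] := T.b - T.a * T.c⁻¹ * T.d

/-- `c z (b - a c⁻¹ d)⁻¹ + d (b - a c⁻¹ d)⁻¹`. -/
def w (z : ℍ[ℝ]) : ℍ[ℝ] := T.c * z * T.e⁻¹ + T.d * T.e⁻¹

open Classical in
/-- The conformal weight `A_T`, a function on the source of `T`. -/
def A (z : ℍ[ℝ]) : ℍ[ℝ] :=
  if T.c = 0 then star T.d else star T.e * ((‖T.w z‖ ^ 4)⁻¹ • star (T.w z))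

open Classical in
/-- The conformal weight `B_T`, a function on the target of `T`. -/
def B (ζ : ℍ[ℝ]) : ℍ[ℝ] :=
  if T.c = 0 then star T.a
  else -(‖ζ - T.a * T.c⁻¹‖ ^ 4 • (star T.c * star (ζ - T.a * T.c⁻¹)))

open Classical in
/-- The factor `C_T`. -/
def C (z : ℍ[ℝ]) : ℍ[ℝ] :=
  if T.c = 0 then (‖T.a‖ ^ 2 / ‖T.d‖) • T.d⁻¹
  else (‖T.c‖ ^ 2 / ‖T.e‖) • (T.e⁻¹ * ((‖T.w z‖ ^ 4)⁻¹ • star (T.w z)))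

open Classical in
/-- The weight `ρ_T`. -/
def rho (z : ℍ[ℝ]) : ℝ := if T.c = 0 then 1 else 1 / ‖T.w z‖ ^ 2

/-- The potential `δ_T = B_T⁻¹ v (A_T ∘ T⁻¹)` on the target of `T`. -/
def delta (v ζ : ℍ[ℝ]) : ℍ[ℝ] := (T.B ζ)⁻¹ * v * T.A (T.inv ζ)

/-- The weight `γ_T(z) = e^{-2⟨v - u, z⟩_θ} ρ_T(z)`. -/
def gamma (θ : ℝ) (u v z : ℍ[ℝ]) : ℝ := Real.exp (-2 * thetaInner θ (v - u) z) * T.rho z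

/-- The point `T(z)` of `Ω`, for `z` in `Ξ` and `T(Ξ) = Ω`. -/
def mapTo {Ξ Ω : Set ℍ[ℝ]} (hT : T.map '' Ξ = Ω) (z : Ξ) : Ω :=
  ⟨T.map z, hT ▸ Set.mem_image_of_mem T.map z.2⟩

/-- The operator `f ↦ e^{⟨v - u, z⟩_θ} C_T (f ∘ T)`. -/
def transfer (θ : ℝ) (u v : ℍ[ℝ]) {Ξ Ω : Set ℍ[ℝ]} (hT : T.map '' Ξ = Ω) (f : Ω → ℍ[ℝ]) :
    Ξ → ℍ[ℝ] :=
  fun z => Real.exp (thetaInner θ (v - u) z) • (T.C z * f (T.mapTo hT z))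

end Mobius

end

end HyperBergman

/-! The proof rests on two covariance identities for `U` and on function theory for the single
potential zero.

Equation. The derivative of `T` at `z` has the form `h ↦ p h q`. Multiplication by `p` and `q` turns
an orthonormal basis into a multiple of another one, so the operator of Cauchy-Riemann type, a sum
over an orthonormal basis, transforms simply when `f ∘ T` is multiplied on the left by a real
multiple of `q` (`fueter_conj`). The value `C_T(z)` is such a multiple. The derivative of `C_T`
contributes nothing, because `C_T` is constant or a left multiple of the Cauchy kernel composed with
an affine map. Hence `D(C_T (f ∘ T)) = r B_T (Df ∘ T)`, with the same real `r` for which `C_T = r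
A_T`. The exponential changes the potential by `v - u`, and `DF + uF = 0` for `F = U f` becomes `Df
+ δ_T f = 0`.

Measure. The Jacobian of `T` is `|C_T|² ρ_T`, and the squared exponential cancels the one in `γ_T`.
So `U` preserves the `L²` inner product (`vol_eq_map`, `qinner_transfer`).

Function theory. Taking `u = 0`, the operator identifies the space on `Ω` with a weighted space of
solutions of `Df = 0` on `Ξ`. These have a mean value property, so locally they are reproduced by
convolution with a radial bump. This bounds evaluations and shows that `L²` limits are again
solutions, whence completeness. Both spaces of the proposition inherit this through `U`. The Riesz
theorem gives the kernels, definiteness their uniqueness, and the transported kernel reproduces, so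
it is the kernel. -/

namespace HyperBergman

noncomputable section

/-! ### The Fueter operator and the Cauchy kernel -/

/-- The imaginary unit `k`. -/
def qk : ℍ[ℝ] := ⟨0, 0, 0, 1⟩

@[simp] theorem qi_re : qi.re = 0 := rfl
@[simp] theorem qi_imI : qi.imI = 1 := rfl
@[simp] theorem qi_imJ : qi.imJ = 0 := rfl
@[simp] theorem qi_imK : qi.imK = 0 := rfl
@[simp] theorem qj_re : qj.re = 0 := rfl
@[simp] theorem qj_imI : qj.imI = 0 := rfl
@[simp] theorem qj_imJ : qj.imJ = 1 := rfl
@[simp] theorem qj_imK : qj.imK = 0 := rfl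
@[simp] theorem qk_re : qk.re = 0 := rfl
@[simp] theorem qk_imI : qk.imI = 0 := rfl
@[simp] theorem qk_imJ : qk.imJ = 0 := rfl
@[simp] theorem qk_imK : qk.imK = 1 := rfl

/-- The Fueter sum `L(1) + i L(i) + j L(j) + k L(k)` of a real linear map. -/
def fueter (L : ℍ[ℝ] →L[ℝ] ℍ[ℝ]) : ℍ[ℝ] := L 1 + qi * L qi + qj * L qj + qk * L qk

theorem map_eq_basis (L : ℍ[ℝ] →L[ℝ] ℍ[ℝ]) (x : ℍ[ℝ]) :
    L x = x.re • L 1 + x.imI • L qi + x.imJ • L qj + x.imK • L qk := by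
  have h : x = x.re • (1 : ℍ[ℝ]) + x.imI • qi + x.imJ • qj + x.imK • qk := by
    ext <;> simp
  have h' := congrArg L h
  simpa only [map_add, map_smul] using h'

theorem psi_one (θ : ℝ) : psi θ 1 = qi := rfl

theorem psi_two (θ : ℝ) : psi θ 2 = -Real.sin θ • qj + Real.cos θ • qk := by
  rw [psi_eq]
  ext <;> simp

theorem psi_three (θ : ℝ) : psi θ 3 = Real.cos θ • qj + Real.sin θ • qk := by
  rw [psi_eq]
  ext <;> simp

/-- The sum contracts the real bilinear map `(x, y) ↦ x * L y`, so it is the same in every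
orthonormal basis. This removes `θ` from the differential equation. -/
theorem sum_psi_mul (θ : ℝ) (L : ℍ[ℝ] →L[ℝ] ℍ[ℝ]) : ∑ k, psi θ k * L (psi θ k) = fueter L := by
  have h := Real.sin_sq_add_cos_sq θ
  have h0 : psi θ 0 = 1 := rfl
  simp only [Fin.sum_univ_four, fueter, h0, psi_one, psi_two, psi_three, map_add, map_smul]
  generalize L 1 = p
  generalize L qi = q
  generalize L qj = r
  generalize L qk = s
  ext <;> simp
  · linear_combination (-r.imJ - s.imK) * h
  · linear_combination (r.imK - s.imJ) * h
  · linear_combination (r.re + s.imI) * h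
  · linear_combination (-r.imI + s.re) * h

theorem thetaD_eq (θ : ℝ) (f : ℍ[ℝ] → ℍ[ℝ]) (z : ℍ[ℝ]) :
    thetaD θ f z = fueter (fderiv ℝ f z) := sum_psi_mul θ _

theorem thetaInner_eq (θ : ℝ) (x y : ℍ[ℝ]) : thetaInner θ x y = inner ℝ x y := by
  have h := Real.sin_sq_add_cos_sq θ
  simp [thetaInner, Quaternion.inner_def, coord, Fin.sum_univ_four]
  linear_combination (x.imJ * y.imJ + x.imK * y.imK) * h

theorem fueter_add (L M : ℍ[ℝ] →L[ℝ] ℍ[ℝ]) : fueter (L + M) = fueter L + fueter M := by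
  simp only [fueter, add_apply, mul_add]; abel

theorem fueter_smul (r : ℝ) (L : ℍ[ℝ] →L[ℝ] ℍ[ℝ]) : fueter (r • L) = r • fueter L := by
  simp [fueter, smul_add]

/-- Conformal covariance of the Fueter sum. -/
theorem fueter_conj {L N : ℍ[ℝ] →L[ℝ] ℍ[ℝ]} (r : ℝ) (p q : ℍ[ℝ])
    (hN : ∀ h, N h = r • (q * L (p * h * q))) :
    fueter N = (r * ‖q‖ ^ 2) • (star p * fueter L) := by
  have hq : ‖q‖ ^ 2 = q.re ^ 2 + q.imI ^ 2 + q.imJ ^ 2 + q.imK ^ 2 := by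
    rw [sq, ← Quaternion.normSq_eq_norm_mul_self, Quaternion.normSq_def']
  rw [hq]
  simp only [fueter, hN]
  -- For nonzero `p`, `q` and a basis vector `e`, the quaternions `f = p e q / (‖p‖ ‖q‖)` form an
  -- orthonormal basis, and `e q L(p e q) = ‖q‖² p̄ f L(f)`. Expansion in coordinates proves the
  -- identity and includes the zero cases.
  have e1 := map_eq_basis L (p * 1 * q)
  have e2 := map_eq_basis L (p * qi * q)
  have e3 := map_eq_basis L (p * qj * q)
  have e4 := map_eq_basis L (p * qk * q)
  simp only [e1, e2, e3, e4]
  generalize L 1 = a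
  generalize L qi = b
  generalize L qj = c
  generalize L qk = d
  ext <;> simp <;> ring

theorem fueter_inner {l x : ℍ[ℝ]} {L : ℍ[ℝ] →L[ℝ] ℍ[ℝ]} (h : ∀ y, L y = inner ℝ l y • x) :
    fueter L = l * x := by
  simp only [fueter, h, Quaternion.inner_def]
  ext <;> simp <;> ring

theorem fueter_star {L : ℍ[ℝ] →L[ℝ] ℍ[ℝ]} (h : ∀ y, L y = star y) :
    fueter L = (4 : ℝ) • 1 := by
  simp only [fueter, h]
  ext <;> (simp; try norm_num)

/-- Quaternionic conjugation as a continuous real linear map. -/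
def conjL : ℍ[ℝ] →L[ℝ] ℍ[ℝ] :=
  LinearMap.toContinuousLinearMap
    { toFun := star, map_add' := star_add, map_smul' := fun r x => by ext <;> simp }

@[simp] theorem conjL_apply (x : ℍ[ℝ]) : conjL x = star x := rfl

/-- The map `h ↦ p h q` as a continuous real linear map. -/
def sandwich (p q : ℍ[ℝ]) : ℍ[ℝ] →L[ℝ] ℍ[ℝ] := ContinuousLinearMap.mulLeftRight ℝ ℍ[ℝ] p q

@[simp] theorem sandwich_apply (p q h : ℍ[ℝ]) : sandwich p q h = p * h * q := rfl

theorem star_eq_smul_inv (x : ℍ[ℝ]) : star x = ‖x‖ ^ 2 • x⁻¹ := by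
  by_cases hx : x = 0
  · simp [hx]
  · have : ‖x‖ ≠ 0 := by simpa using hx
    rw [Quaternion.instInv, sq, ← Quaternion.normSq_eq_norm_mul_self]
    change star x = _ • ((Quaternion.normSq x)⁻¹ • star x)
    rw [smul_smul, mul_inv_cancel₀, one_smul]
    rwa [Quaternion.normSq_ne_zero]

theorem self_mul_star_eq (x : ℍ[ℝ]) : x * star x = (‖x‖ ^ 2) • (1 : ℍ[ℝ]) := by
  by_cases hx : x = 0
  · simp [hx]
  · rw [star_eq_smul_inv, mul_smul_comm, mul_inv_cancel₀ hx]

theorem fueter_mul_right {L M : ℍ[ℝ] →L[ℝ] ℍ[ℝ]} {x : ℍ[ℝ]} (h : ∀ y, M y = L y * x) :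
    fueter M = fueter L * x := by
  simp [fueter, h, add_mul, mul_assoc]

/-- The Cauchy kernel `x̄ / |x|⁴`, up to a constant. -/
def cauchyKernel (x : ℍ[ℝ]) : ℍ[ℝ] := (‖x‖ ^ 4)⁻¹ • star x

/-- By the product rule, conjugation contributes `4 ‖x‖⁻⁴` and the gradient of `‖x‖⁻⁴` contributes
`-4 ‖x‖⁻⁶ x x̄ = -4 ‖x‖⁻⁴`. -/
theorem hasFDerivAt_cauchyKernel {x : ℍ[ℝ]} (hx : x ≠ 0) :
    ∃ L, HasFDerivAt cauchyKernel L x ∧ fueter L = 0 := by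
  have hn : ‖x‖ ≠ 0 := by simpa using hx
  have h1 : HasFDerivAt (fun y : ℍ[ℝ] => ‖y‖ ^ 2) ((2 : ℕ) • innerSL ℝ x) x :=
    (hasStrictFDerivAt_norm_sq x).hasFDerivAt
  have h2 := (hasDerivAt_inv (pow_ne_zero 2 (pow_ne_zero 2 hn))).comp_hasFDerivAt x (h1.pow 2)
  have h3 := h2.smul conjL.hasFDerivAt
  have he : cauchyKernel = ((fun y => y⁻¹) ∘ fun y : ℍ[ℝ] => (‖y‖ ^ 2) ^ 2) • ⇑conjL := by
    funext y
    simp [cauchyKernel, ← pow_mul]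
  rw [← he] at h3
  refine ⟨_, h3, ?_⟩
  rw [fueter_add, fueter_smul, fueter_star conjL_apply, fueter_inner
    (l := x) (x := (-4 * (‖x‖ ^ 6)⁻¹) • star x)]
  · rw [mul_smul_comm, self_mul_star_eq, smul_smul, smul_smul, ← add_smul]
    convert zero_smul ℝ (1 : ℍ[ℝ])
    simp
    field_simp
    ring
  · intro y
    simp [smul_smul]
    congr 1
    field_simp
    ring

theorem contDiffAt_quaternion_inv {x : ℍ[ℝ]} (hx : x ≠ 0) {n : ℕ∞} :
    ContDiffAt ℝ n (fun y : ℍ[ℝ] => y⁻¹) x := by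
  have h := contDiffAt_ringInverse (n := n) ℝ (Units.mk0 x hx)
  rwa [Ring.inverse_eq_inv'] at h

theorem contDiffAt_cauchyKernel {x : ℍ[ℝ]} (hx : x ≠ 0) {n : ℕ∞} : ContDiffAt ℝ n cauchyKernel x := by
  have hn : ‖x‖ ^ 4 ≠ 0 := by simpa using hx
  have h : ContDiffAt ℝ n (fun y : ℍ[ℝ] => ‖y‖ ^ 4) x := by
    have := ((contDiff_norm_sq ℝ (E := ℍ[ℝ]) (n := n)).pow 2).contDiffAt (x := x)
    simpa [← pow_mul] using this
  exact (h.inv hn).smul conjL.contDiff.contDiffAt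

/-! ### Möbius maps and their conformal weights -/

namespace Mobius

variable (T : Mobius)

theorem a_ne_zero (hc : T.c = 0) : T.a ≠ 0 := left_ne_zero_of_mul (T.affine_nondeg hc)
theorem d_ne_zero (hc : T.c = 0) : T.d ≠ 0 := right_ne_zero_of_mul (T.affine_nondeg hc)
theorem e_ne_zero (hc : T.c ≠ 0) : T.e ≠ 0 := T.nondeg hc

theorem w_eq (z : ℍ[ℝ]) : T.w z = (T.c * z + T.d) * T.e⁻¹ := (add_mul _ _ _).symm

variable {T}

theorem w_ne_zero (hc : T.c ≠ 0) {z : ℍ[ℝ]} (hz : z ∈ T.finiteSet) : T.w z ≠ 0 := by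
  rw [w_eq]
  exact mul_ne_zero hz (inv_ne_zero (T.e_ne_zero hc))

theorem map_affine (hc : T.c = 0) (z : ℍ[ℝ]) : T.map z = T.a * z * T.d⁻¹ + T.b * T.d⁻¹ := by
  simp [map, hc, add_mul]

/-- Splitting off the value `a c⁻¹` at infinity writes `T` as the affine map `w`, an inversion and a
translation. Injectivity, the inverse and the derivative are read off from this form. -/
theorem map_eq (hc : T.c ≠ 0) {z : ℍ[ℝ]} (hz : z ∈ T.finiteSet) :
    T.map z = T.a * T.c⁻¹ + (T.w z)⁻¹ := by
  have hz' : T.c * z + T.d ≠ 0 := hz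
  rw [w_eq, mul_inv_rev, inv_inv, map, e]
  rw [← mul_left_inj' hz', inv_mul_cancel_right₀ hz', add_mul, inv_mul_cancel_right₀ hz']
  rw [mul_add, ← mul_assoc, inv_mul_cancel_right₀ hc]
  abel

theorem isOpen_finiteSet : IsOpen T.finiteSet :=
  isOpen_ne_fun (by fun_prop) continuous_const

theorem contDiffAt_w (z : ℍ[ℝ]) {n : ℕ∞} : ContDiffAt ℝ n T.w z := by
  unfold w
  fun_prop

theorem hasFDerivAt_w (z : ℍ[ℝ]) : HasFDerivAt T.w (sandwich T.c T.e⁻¹) z := by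
  have : T.w = fun y => sandwich T.c T.e⁻¹ y + T.d * T.e⁻¹ := rfl
  rw [this]
  exact (sandwich T.c T.e⁻¹).hasFDerivAt.add_const _

theorem contDiffAt_map {z : ℍ[ℝ]} (hz : z ∈ T.finiteSet) {n : ℕ∞} : ContDiffAt ℝ n T.map z := by
  unfold map
  have hz' : T.c * z + T.d ≠ 0 := hz
  refine ContDiffAt.mul (by fun_prop) ?_
  exact (contDiffAt_quaternion_inv hz').comp z (f := fun z => T.c * z + T.d) (by fun_prop)

theorem hasFDerivAt_map_affine (hc : T.c = 0) (z : ℍ[ℝ]) :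
    HasFDerivAt T.map (sandwich T.a T.d⁻¹) z := by
  have : T.map = fun y => sandwich T.a T.d⁻¹ y + T.b * T.d⁻¹ := funext (map_affine hc)
  rw [this]
  exact (sandwich T.a T.d⁻¹).hasFDerivAt.add_const _

theorem hasFDerivAt_map (hc : T.c ≠ 0) {z : ℍ[ℝ]} (hz : z ∈ T.finiteSet) :
    HasFDerivAt T.map (sandwich (-(T.w z)⁻¹ * T.c) (T.e⁻¹ * (T.w z)⁻¹)) z := by
  have h := ((hasFDerivAt_inv' (𝕜 := ℝ) (w_ne_zero hc hz)).comp z (hasFDerivAt_w z)).const_add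
    (T.a * T.c⁻¹)
  have h' := h.congr_of_eventuallyEq (f₁ := T.map) (by
    filter_upwards [isOpen_finiteSet.mem_nhds hz] with y hy using map_eq hc hy)
  refine h'.congr_fderiv (ContinuousLinearMap.ext fun x => ?_)
  simp [mul_assoc]

theorem injOn_map : Set.InjOn T.map T.finiteSet := by
  intro x hx y hy hxy
  by_cases hc : T.c = 0
  · have ha := T.a_ne_zero hc
    have hd := T.d_ne_zero hc
    rw [map_affine hc, map_affine hc, add_left_inj, mul_left_inj' (inv_ne_zero hd),
      mul_right_inj' ha] at hxy
    exact hxy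
  · have he := T.e_ne_zero hc
    rw [map_eq hc hx, map_eq hc hy, add_right_inj, inv_inj, w_eq, w_eq,
      mul_left_inj' (inv_ne_zero he), add_left_inj, mul_right_inj' hc] at hxy
    exact hxy

theorem inv_map {z : ℍ[ℝ]} (hz : z ∈ T.finiteSet) : T.inv (T.map z) = z :=
  injOn_map.leftInvOn_invFunOn hz

/-- The inverse of a Möbius map has a smooth extension near every value. -/
theorem exists_contDiffAt_inv {z : ℍ[ℝ]} (hz : z ∈ T.finiteSet) :
    ∃ g : ℍ[ℝ] → ℍ[ℝ], ContDiffAt ℝ 1 g (T.map z) ∧ ∀ y ∈ T.finiteSet, g (T.map y) = y := by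
  by_cases hc : T.c = 0
  · have ha := T.a_ne_zero hc
    have hd := T.d_ne_zero hc
    refine ⟨fun y => T.a⁻¹ * ((y - T.b * T.d⁻¹) * T.d), by fun_prop, fun y _ => ?_⟩
    simp only [map_affine hc]
    rw [add_sub_cancel_right, inv_mul_cancel_right₀ hd, inv_mul_cancel_left₀ ha]
  · have he := T.e_ne_zero hc
    refine ⟨fun y => T.c⁻¹ * ((y - T.a * T.c⁻¹)⁻¹ * T.e - T.d), ?_, fun y hy => ?_⟩
    · have h0 : T.map z - T.a * T.c⁻¹ ≠ 0 := by
        rw [map_eq hc hz, add_sub_cancel_left]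
        exact inv_ne_zero (w_ne_zero hc hz)
      have h1 : ContDiffAt ℝ 1 (fun y : ℍ[ℝ] => (y - T.a * T.c⁻¹)⁻¹) (T.map z) :=
        (contDiffAt_quaternion_inv h0).comp (T.map z) (f := fun y => y - T.a * T.c⁻¹)
          (by fun_prop)
      fun_prop
    · simp only
      rw [map_eq hc hy, add_sub_cancel_left, inv_inv, w_eq, inv_mul_cancel_right₀ he,
        add_sub_cancel_right, inv_mul_cancel_left₀ hc]

variable (T) in
open Classical in
/-- The constant ratio of `C_T` and `A_T`. -/
def ratio : ℝ := if T.c = 0 then ‖T.a‖ ^ 2 / ‖T.d‖ ^ 3 else ‖T.c‖ ^ 2 / ‖T.e‖ ^ 3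

theorem ratio_pos : 0 < T.ratio := by
  unfold ratio
  split_ifs with hc
  · have ha := norm_pos_iff.2 (T.a_ne_zero hc)
    have hd := norm_pos_iff.2 (T.d_ne_zero hc)
    positivity
  · have ha := norm_pos_iff.2 hc
    have hd := norm_pos_iff.2 (T.e_ne_zero hc)
    positivity

/-- A conjugate is a real multiple of the inverse. The constant agrees with the one produced by
differentiation, which lets it be factored out of the whole equation. -/
theorem C_eq_ratio_smul (z : ℍ[ℝ]) : T.C z = T.ratio • T.A z := by
  unfold C ratio A
  split_ifs with hc
  · have hd := norm_ne_zero_iff.2 (T.d_ne_zero hc)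
    rw [star_eq_smul_inv, smul_smul]
    congr 1
    field_simp
  · have hd := norm_ne_zero_iff.2 (T.e_ne_zero hc)
    rw [star_eq_smul_inv T.e, smul_mul_assoc, smul_smul]
    congr 1
    field_simp

theorem C_ne_zero {z : ℍ[ℝ]} (hz : z ∈ T.finiteSet) : T.C z ≠ 0 := by
  unfold C
  split_ifs with hc
  · have ha := norm_ne_zero_iff.2 (T.a_ne_zero hc)
    have hd := norm_ne_zero_iff.2 (T.d_ne_zero hc)
    exact smul_ne_zero (by positivity) (inv_ne_zero (T.d_ne_zero hc))
  · have ha := norm_ne_zero_iff.2 hc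
    have hd := norm_ne_zero_iff.2 (T.e_ne_zero hc)
    have hw := norm_ne_zero_iff.2 (w_ne_zero hc hz)
    exact smul_ne_zero (by positivity) (mul_ne_zero (inv_ne_zero (T.e_ne_zero hc))
      (smul_ne_zero (by positivity) (star_ne_zero.2 (w_ne_zero hc hz))))

theorem B_ne_zero {z : ℍ[ℝ]} (hz : z ∈ T.finiteSet) : T.B (T.map z) ≠ 0 := by
  unfold B
  split_ifs with hc
  · exact star_ne_zero.2 (T.a_ne_zero hc)
  · rw [map_eq hc hz, add_sub_cancel_left]
    have hw := inv_ne_zero (w_ne_zero hc hz)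
    have hw' := norm_ne_zero_iff.2 hw
    exact neg_ne_zero.2 (smul_ne_zero (by positivity)
      (mul_ne_zero (star_ne_zero.2 hc) (star_ne_zero.2 hw)))

theorem contDiffAt_C {z : ℍ[ℝ]} (hz : z ∈ T.finiteSet) {n : ℕ∞} : ContDiffAt ℝ n T.C z := by
  unfold C
  split_ifs with hc
  · exact contDiffAt_const
  · have : ContDiffAt ℝ n (fun z => cauchyKernel (T.w z)) z :=
      (contDiffAt_cauchyKernel (w_ne_zero hc hz)).comp z (contDiffAt_w z)
    exact (contDiffAt_const (c := ‖T.c‖ ^ 2 / ‖T.e‖)).smul (contDiffAt_const.mul this)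

/-- Conformal covariance of the Fueter operator under Möbius maps. -/
theorem fueter_fderiv_C_mul {z : ℍ[ℝ]} (hz : z ∈ T.finiteSet) {f : ℍ[ℝ] → ℍ[ℝ]}
    (hf : DifferentiableAt ℝ f (T.map z)) :
    fueter (fderiv ℝ (fun y => T.C y * f (T.map y)) z)
      = T.ratio • (T.B (T.map z) * fueter (fderiv ℝ f (T.map z))) := by
  by_cases hc : T.c = 0
  · have h := (hf.hasFDerivAt.comp z (hasFDerivAt_map_affine hc z)).const_mul (T.C z)
    have hC : (fun y => T.C y * f (T.map y)) = fun y => T.C z * (f ∘ T.map) y := by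
      funext y
      simp [C, hc]
    have hd := norm_ne_zero_iff.2 (T.d_ne_zero hc)
    rw [hC, h.fderiv, fueter_conj (L := fderiv ℝ f (T.map z)) (‖T.a‖ ^ 2 / ‖T.d‖) T.a T.d⁻¹]
    · simp only [B, ratio, if_pos hc, norm_inv]
      congr 1
      field_simp
    · intro x
      simp [C, hc]
  · have hw := w_ne_zero hc hz
    have he := T.e_ne_zero hc
    have hwn := norm_ne_zero_iff.2 hw
    have hen := norm_ne_zero_iff.2 he
    obtain ⟨E', hE, hE0⟩ := hasFDerivAt_cauchyKernel hw
    set s := ‖T.c‖ ^ 2 / ‖T.e‖ with hs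
    have hC : ∀ y, T.C y = s • (T.e⁻¹ * cauchyKernel (T.w y)) := by
      intro y
      simp [C, hc, cauchyKernel, hs]
    have h1 : HasFDerivAt T.C (s • (sandwich T.e⁻¹ 1).comp (E'.comp (sandwich T.c T.e⁻¹))) z := by
      have := (((sandwich T.e⁻¹ 1).hasFDerivAt).comp z (hE.comp z (hasFDerivAt_w z))).const_smul s
      refine this.congr_of_eventuallyEq (Filter.Eventually.of_forall fun y => ?_)
      simp [hC]
    have h2 := hf.hasFDerivAt.comp z (hasFDerivAt_map hc hz)
    have h3 := h1.mul' h2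
    have hN : fderiv ℝ (fun y => T.C y * f (T.map y)) z
        = s • (sandwich T.e⁻¹ (f (T.map z))).comp (E'.comp (sandwich T.c T.e⁻¹))
        + (sandwich (T.C z) 1).comp
          ((fderiv ℝ f (T.map z)).comp (sandwich (-(T.w z)⁻¹ * T.c) (T.e⁻¹ * (T.w z)⁻¹))) := by
      refine h3.fderiv.trans (ContinuousLinearMap.ext fun x => ?_)
      simp [mul_assoc, add_comm]
    -- In the first term `C_T` is differentiated, and the regularity of the Cauchy kernel makes it
    -- vanish. In the second, `C_T = s ‖w‖⁻² e⁻¹ w⁻¹` is a real multiple of the right factor of the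
    -- derivative of `T`, as `fueter_conj` requires.
    rw [hN, fueter_add,
      fueter_conj (L := (sandwich 1 (f (T.map z))).comp E') s T.c T.e⁻¹ (by intro h; simp [mul_assoc]),
      fueter_mul_right (L := E') (x := f (T.map z)) (by intro h; simp), hE0,
      fueter_conj (L := fderiv ℝ f (T.map z)) (s * (‖T.w z‖ ^ 2)⁻¹) (-(T.w z)⁻¹ * T.c)
        (T.e⁻¹ * (T.w z)⁻¹)]
    · simp only [B, ratio, if_neg hc, map_eq hc hz, add_sub_cancel_left, zero_mul, mul_zero,
        smul_zero, zero_add, norm_mul, norm_inv, star_mul, star_neg, neg_mul, smul_neg,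
        smul_mul_assoc, smul_smul, hs]
      congr 2
      field_simp
    · intro h
      simp [hC, cauchyKernel, star_eq_smul_inv, smul_smul, mul_assoc]
      congr 1
      field_simp

end Mobius

/-! ### Transfer of the differential equation -/

theorem zeroExt_apply {Ω : Set ℍ[ℝ]} (f : Ω → ℍ[ℝ]) (z : Ω) : zeroExt f z = f z :=
  Subtype.val_injective.extend_apply f 0 z

theorem zeroExt_of_mem {Ω : Set ℍ[ℝ]} (f : Ω → ℍ[ℝ]) {z : ℍ[ℝ]} (hz : z ∈ Ω) :
    zeroExt f z = f ⟨z, hz⟩ := zeroExt_apply f ⟨z, hz⟩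

theorem mem_regular {θ : ℝ} {Ω : Set ℍ[ℝ]} {δ : ℍ[ℝ] → ℍ[ℝ]} {f : Ω → ℍ[ℝ]} :
    f ∈ regular θ Ω δ ↔ ∀ z : Ω, ContDiffAt ℝ 1 (zeroExt f) z ∧
      fueter (fderiv ℝ (zeroExt f) z) + δ z * f z = 0 := by
  simp only [← thetaD_eq θ]
  rfl

/-- The Fueter operator applied to `e^{⟨l, ·⟩} F`. -/
theorem fueter_fderiv_exp_smul (l : ℍ[ℝ]) {F : ℍ[ℝ] → ℍ[ℝ]} {z : ℍ[ℝ]}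
    (hF : DifferentiableAt ℝ F z) :
    fueter (fderiv ℝ (fun y => Real.exp (inner ℝ l y) • F y) z)
      = Real.exp (inner ℝ l z) • (fueter (fderiv ℝ F z) + l * F z) := by
  have h1 : HasFDerivAt (fun y => Real.exp (inner ℝ l y))
      (Real.exp (inner ℝ l z) • innerSL ℝ l) z := ((innerSL ℝ l).hasFDerivAt (x := z)).exp
  have h2 : fderiv ℝ (fun y => Real.exp (inner ℝ l y) • F y) z = _ :=
    (h1.smul hF.hasFDerivAt).fderiv
  have h3 : fueter ((Real.exp (inner ℝ l z) • innerSL ℝ l).smulRight (F z))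
      = Real.exp (inner ℝ l z) • (l * F z) := by
    rw [fueter_inner (l := Real.exp (inner ℝ l z) • l) (x := F z), smul_mul_assoc]
    intro y
    simp [inner_smul_left]
  rw [h2, fueter_add, fueter_smul, h3, smul_add]

namespace Mobius

variable {T : Mobius}

theorem B_mul_delta {z : ℍ[ℝ]} (hz : z ∈ T.finiteSet) (v : ℍ[ℝ]) :
    T.B (T.map z) * T.delta v (T.map z) = v * T.A z := by
  rw [delta, inv_map hz, mul_assoc, mul_inv_cancel_left₀ (B_ne_zero hz)]

theorem zeroExt_transfer_eventuallyEq {θ : ℝ} {u v : ℍ[ℝ]} {Ξ Ω : Set ℍ[ℝ]} (hΞ : IsOpen Ξ)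
    (hT : T.map '' Ξ = Ω) (f : Ω → ℍ[ℝ]) (z : Ξ) :
    zeroExt (T.transfer θ u v hT f) =ᶠ[nhds z.1]
      fun y => Real.exp (inner ℝ (v - u) y) • (T.C y * zeroExt f (T.map y)) := by
  filter_upwards [hΞ.mem_nhds z.2] with y hy
  have hy' : T.map y ∈ Ω := hT ▸ Set.mem_image_of_mem _ hy
  rw [zeroExt_of_mem _ hy, zeroExt_of_mem _ hy', transfer, thetaInner_eq]
  rfl

theorem fueter_zeroExt_transfer {θ : ℝ} {u v : ℍ[ℝ]} {Ξ Ω : Set ℍ[ℝ]} (hΞ : IsOpen Ξ)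
    (hfin : Ξ ⊆ T.finiteSet) (hT : T.map '' Ξ = Ω) (f : Ω → ℍ[ℝ]) (z : Ξ)
    (hf : DifferentiableAt ℝ (zeroExt f) (T.mapTo hT z)) :
    fueter (fderiv ℝ (zeroExt (T.transfer θ u v hT f)) z) + u * T.transfer θ u v hT f z
      = (Real.exp (inner ℝ (v - u) z.1) * T.ratio) • (T.B (T.map z) *
        (fueter (fderiv ℝ (zeroExt f) (T.mapTo hT z))
          + T.delta v (T.mapTo hT z) * f (T.mapTo hT z))) := by
  have hz := hfin z.2
  have hf' : DifferentiableAt ℝ (fun y => T.C y * zeroExt f (T.map y)) z.1 :=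
    ((contDiffAt_C hz (n := 1)).differentiableAt one_ne_zero).mul
      (DifferentiableAt.comp z.1 hf ((contDiffAt_map hz (n := 1)).differentiableAt one_ne_zero))
  rw [(zeroExt_transfer_eventuallyEq hΞ hT f z).fderiv_eq, fueter_fderiv_exp_smul _ hf',
    fueter_fderiv_C_mul hz hf, transfer, thetaInner_eq]
  have h1 : zeroExt f (T.map z) = f (T.mapTo hT z) := zeroExt_apply f (T.mapTo hT z)
  have h2 : (T.mapTo hT z).1 = T.map z := rfl
  rw [h1, h2, mul_add, ← mul_assoc (T.B _), B_mul_delta hz, C_eq_ratio_smul]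
  simp only [smul_mul_assoc, mul_smul_comm, mul_smul, smul_add, sub_mul, mul_assoc, smul_sub]
  abel

/-- The weighted pull-back by a Möbius map preserves and reflects regularity. -/
theorem transfer_mem_regular_iff {θ : ℝ} {u v : ℍ[ℝ]} {Ξ Ω : Set ℍ[ℝ]} (hΞ : IsOpen Ξ)
    (hΩ : IsOpen Ω) (hfin : Ξ ⊆ T.finiteSet) (hT : T.map '' Ξ = Ω) (f : Ω → ℍ[ℝ]) :
    T.transfer θ u v hT f ∈ regular θ Ξ (fun _ => u) ↔ f ∈ regular θ Ω (T.delta v) := by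
  have hsurj : ∀ ζ : Ω, ∃ z, T.mapTo hT z = ζ := by
    rintro ⟨ζ, hζ⟩
    obtain ⟨z, hz, rfl⟩ := hT.symm ▸ hζ
    exact ⟨⟨z, hz⟩, rfl⟩
  have hsm : ∀ z : Ξ, ContDiffAt ℝ 1 (fun y : ℍ[ℝ] => Real.exp (inner ℝ (v - u) y)) z.1 :=
    fun z => (contDiffAt_const.inner ℝ contDiffAt_id).exp
  have key : ∀ z : Ξ, ContDiffAt ℝ 1 (zeroExt (T.transfer θ u v hT f)) z ↔
      ContDiffAt ℝ 1 (zeroExt f) (T.mapTo hT z) := by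
    intro z
    have hz := hfin z.2
    constructor
    · intro h
      obtain ⟨g, hg, hgT⟩ := exists_contDiffAt_inv hz
      have hgz : g (T.map z) = z := hgT z hz
      -- To recover smoothness of `f`, the nonvanishing factors are divided out and the result is
      -- composed with a smooth local inverse.
      have hF : zeroExt f =ᶠ[nhds (T.map z)] fun ζ => (T.C (g ζ))⁻¹ *
          (Real.exp (inner ℝ (v - u) (g ζ)))⁻¹ • zeroExt (T.transfer θ u v hT f) (g ζ) := by
        filter_upwards [hΩ.mem_nhds (T.mapTo hT z).2] with ζ hζ
        obtain ⟨y, hy⟩ := hsurj ⟨ζ, hζ⟩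
        have hy' : T.map y = ζ := congrArg Subtype.val hy
        have hyf := hfin y.2
        rw [← hy', hgT y hyf, zeroExt_apply, transfer, thetaInner_eq, smul_smul,
          inv_mul_cancel₀ (Real.exp_pos _).ne', one_smul, inv_mul_cancel_left₀ (C_ne_zero hyf)]
        exact zeroExt_apply f (T.mapTo hT y)
      refine ContDiffAt.congr_of_eventuallyEq ?_ hF
      have hC : ContDiffAt ℝ 1 (fun ζ => (T.C (g ζ))⁻¹) (T.map z) := by
        have h1 : ContDiffAt ℝ 1 (fun y => (T.C y)⁻¹) (g (T.map z)) := by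
          rw [hgz]
          exact (contDiffAt_quaternion_inv (C_ne_zero hz)).comp z.1 (contDiffAt_C hz (n := 1))
        exact h1.comp _ hg
      have hE : ContDiffAt ℝ 1 (fun ζ => (Real.exp (inner ℝ (v - u) (g ζ)))⁻¹) (T.map z) := by
        have h1 : ContDiffAt ℝ 1 (fun ζ => inner ℝ (v - u) (g ζ)) (T.map z) :=
          contDiffAt_const.inner ℝ hg
        exact h1.exp.inv (Real.exp_pos _).ne'
      have hG : ContDiffAt ℝ 1 (fun ζ => zeroExt (T.transfer θ u v hT f) (g ζ)) (T.map z) := by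
        rw [← hgz] at h
        exact h.comp _ hg
      exact hC.mul (hE.smul hG)
    · intro h
      refine ContDiffAt.congr_of_eventuallyEq ?_ (zeroExt_transfer_eventuallyEq hΞ hT f z)
      exact (hsm z).smul ((contDiffAt_C hz (n := 1)).mul
        (ContDiffAt.comp z.1 h (contDiffAt_map hz (n := 1))))
  have key2 : ∀ z : Ξ, (ContDiffAt ℝ 1 (zeroExt (T.transfer θ u v hT f)) z ∧
      fueter (fderiv ℝ (zeroExt (T.transfer θ u v hT f)) z) + u * T.transfer θ u v hT f z = 0) ↔
      (ContDiffAt ℝ 1 (zeroExt f) (T.mapTo hT z) ∧ fueter (fderiv ℝ (zeroExt f) (T.mapTo hT z))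
          + T.delta v (T.mapTo hT z) * f (T.mapTo hT z) = 0) := by
    intro z
    rw [key z]
    refine and_congr_right fun h => ?_
    rw [fueter_zeroExt_transfer hΞ hfin hT f z (h.differentiableAt one_ne_zero), 
      smul_eq_zero_iff_right (mul_pos (Real.exp_pos _) ratio_pos).ne',
      mul_eq_zero_iff_left (B_ne_zero (hfin z.2))]
  rw [mem_regular, mem_regular]
  constructor
  · intro h ζ
    obtain ⟨z, rfl⟩ := hsurj ζ
    exact (key2 z).1 (h z)
  · exact fun h z => (key2 z).2 (h _)

end Mobius

open MeasureTheory

/-! ### Weighted pull-backs of square integrable functions -/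

section Pullback

variable {X Y : Type*} [MeasurableSpace X] [MeasurableSpace Y] {μ : Measure Y} {ν : Measure X}
  {τ : X → Y} {m : X → ℍ[ℝ]}

/-- Since `m` has no zeros, the two measures have the same null sets, so measurability passes both
ways. The squared norms then have the same integral. -/
theorem memLp_mul_withDensity_iff (hm : Measurable m) (hm0 : ∀ x, m x ≠ 0) (f : X → ℍ[ℝ]) :
    MemLp (fun x => m x * f x) 2 ν ↔
      MemLp f 2 (ν.withDensity fun x => ENNReal.ofReal (‖m x‖ ^ 2)) := by
  have hd : Measurable fun x => ENNReal.ofReal (‖m x‖ ^ 2) := by fun_prop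
  have hac := withDensity_absolutelyContinuous ν fun x => ENNReal.ofReal (‖m x‖ ^ 2)
  have hac' : ν ≪ ν.withDensity fun x => ENNReal.ofReal (‖m x‖ ^ 2) := by
    refine withDensity_absolutelyContinuous' hd.aemeasurable (Filter.Eventually.of_forall fun x => ?_)
    have := norm_pos_iff.2 (hm0 x)
    simp [hm0 x]
  have hmeas : AEStronglyMeasurable (fun x => m x * f x) ν ↔
      AEStronglyMeasurable f (ν.withDensity fun x => ENNReal.ofReal (‖m x‖ ^ 2)) := by
    constructor
    · intro h
      have h1 : AEStronglyMeasurable (fun x => (m x)⁻¹ * (m x * f x)) ν :=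
        hm.inv.aestronglyMeasurable.mul h
      simp only [inv_mul_cancel_left₀ (hm0 _)] at h1
      exact h1.mono_ac hac
    · exact fun h => hm.aestronglyMeasurable.mul (h.mono_ac hac')
  by_cases h : AEStronglyMeasurable (fun x => m x * f x) ν
  · rw [memLp_two_iff_integrable_sq_norm h, memLp_two_iff_integrable_sq_norm (hmeas.1 h),
      integrable_withDensity_iff_integrable_smul' hd (by simp)]
    refine integrable_congr (Filter.Eventually.of_forall fun x => ?_)
    simp [mul_pow]
  · exact ⟨fun h' => absurd h'.1 h, fun h' => absurd (hmeas.2 h'.1) h⟩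

theorem memLp_pullback_iff (hτ : MeasurableEmbedding τ) (hm : Measurable m) (hm0 : ∀ x, m x ≠ 0)
    (hμ : μ = Measure.map τ (ν.withDensity fun x => ENNReal.ofReal (‖m x‖ ^ 2))) (f : Y → ℍ[ℝ]) :
    MemLp (fun x => m x * f (τ x)) 2 ν ↔ MemLp f 2 μ := by
  rw [hμ, hτ.memLp_map_measure_iff, memLp_mul_withDensity_iff hm hm0]
  rfl

theorem integral_pullback (hτ : MeasurableEmbedding τ) (hm : Measurable m)
    (hμ : μ = Measure.map τ (ν.withDensity fun x => ENNReal.ofReal (‖m x‖ ^ 2)))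
    (f g : Y → ℍ[ℝ]) :
    ∫ x, star (m x * f (τ x)) * (m x * g (τ x)) ∂ν = ∫ y, star (f y) * g y ∂μ := by
  rw [hμ, hτ.integral_map, integral_withDensity_eq_integral_toReal_smul (by fun_prop) (by simp)]
  congr 1
  funext x
  have h : star (m x) * m x = (‖m x‖ ^ 2) • (1 : ℍ[ℝ]) := by
    simpa using self_mul_star_eq (star (m x))
  rw [ENNReal.toReal_ofReal (by positivity), star_mul, mul_assoc, ← mul_assoc (star (m x)), h,
    smul_mul_assoc, one_mul, mul_smul_comm]

end Pullback

/-! ### Change of variables under Möbius maps -/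

theorem norm_sandwich (p q h : ℍ[ℝ]) : ‖sandwich p q h‖ = ‖p‖ * ‖q‖ * ‖h‖ := by
  rw [sandwich_apply, norm_mul, norm_mul]; ring

/-- The map multiplies norms by `‖p‖ ‖q‖`, so it carries the unit ball onto the ball of that radius.
Comparing volumes in dimension four gives the determinant. -/
theorem abs_det_sandwich {p q : ℍ[ℝ]} (hp : p ≠ 0) (hq : q ≠ 0) :
    |(sandwich p q).det| = (‖p‖ * ‖q‖) ^ 4 := by
  have hr : 0 < ‖p‖ * ‖q‖ := mul_pos (norm_pos_iff.2 hp) (norm_pos_iff.2 hq)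
  have himg : sandwich p q '' Metric.ball 0 1 = Metric.ball 0 (‖p‖ * ‖q‖) := by
    ext y
    simp only [Set.mem_image, mem_ball_zero_iff]
    constructor
    · rintro ⟨x, hx, rfl⟩
      rw [norm_sandwich]
      exact mul_lt_of_lt_one_right hr hx
    · intro hy
      refine ⟨p⁻¹ * y * q⁻¹, ?_, ?_⟩
      · rw [norm_mul, norm_mul, norm_inv, norm_inv, mul_right_comm, ← mul_inv,
          inv_mul_lt_iff₀ hr, mul_one]
        exact hy
      · rw [sandwich_apply, mul_assoc p⁻¹, mul_inv_cancel_left₀ hp, inv_mul_cancel_right₀ hq]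
  have h := Measure.addHaar_image_continuousLinearMap volume (sandwich p q) (Metric.ball 0 1)
  rw [himg, Measure.addHaar_ball_of_pos volume 0 hr, Quaternion.finrank_eq_four] at h
  have h' := (ENNReal.mul_left_inj (Metric.measure_ball_pos volume 0 one_pos).ne'
    measure_ball_lt_top.ne).1 h
  exact ((ENNReal.ofReal_eq_ofReal_iff (by positivity) (abs_nonneg _)).1 h').symm

theorem measurableEmbedding_val {Ω : Set ℍ[ℝ]} (hΩ : IsOpen Ω) :
    MeasurableEmbedding (Subtype.val : Ω → ℍ[ℝ]) := MeasurableEmbedding.subtype_coe hΩ.measurableSet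

theorem map_val_withDensity {Ω : Set ℍ[ℝ]} (hΩ : IsOpen Ω) (γ : ℍ[ℝ] → ENNReal) :
    Measure.map Subtype.val ((vol Ω).withDensity fun z => γ z)
      = (volume.restrict Ω).withDensity γ := by
  have he := measurableEmbedding_val hΩ
  ext s hs
  rw [Measure.map_apply measurable_subtype_coe hs,
    withDensity_apply _ (measurable_subtype_coe hs), withDensity_apply _ hs,
    ← map_comap_subtype_coe hΩ.measurableSet, he.restrict_map, he.lintegral_map]
  rfl

namespace Mobius

variable {T : Mobius}

theorem rho_pos {z : ℍ[ℝ]} (hz : z ∈ T.finiteSet) : 0 < T.rho z := by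
  unfold rho
  split_ifs with hc
  · exact one_pos
  · have := norm_pos_iff.2 (w_ne_zero hc hz)
    positivity

theorem continuousOn_rho : ContinuousOn T.rho T.finiteSet := by
  unfold rho
  by_cases hc : T.c = 0
  · simp only [hc, if_true]
    exact continuousOn_const
  · simp only [hc, if_false]
    have hw : Continuous T.w := continuous_iff_continuousAt.2 fun z =>
      (contDiffAt_w z (n := 0)).continuousAt
    refine continuousOn_const.div (hw.norm.pow 2).continuousOn fun z hz => ?_
    have := norm_pos_iff.2 (w_ne_zero hc hz)
    positivity

theorem gamma_pos (θ : ℝ) (u v : ℍ[ℝ]) {z : ℍ[ℝ]} (hz : z ∈ T.finiteSet) :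
    0 < T.gamma θ u v z := mul_pos (Real.exp_pos _) (rho_pos hz)

theorem continuousOn_gamma (θ : ℝ) (u v : ℍ[ℝ]) :
    ContinuousOn (T.gamma θ u v) T.finiteSet := by
  unfold gamma
  simp only [thetaInner_eq]
  exact (by fun_prop : Continuous fun z => Real.exp (-2 * inner ℝ (v - u) z)).continuousOn.mul
    continuousOn_rho

theorem exists_hasFDerivAt_map {z : ℍ[ℝ]} (hz : z ∈ T.finiteSet) :
    ∃ L : ℍ[ℝ] →L[ℝ] ℍ[ℝ], HasFDerivAt T.map L z ∧ |L.det| = ‖T.C z‖ ^ 2 * T.rho z := by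
  by_cases hc : T.c = 0
  · have ha := T.a_ne_zero hc
    have hd := T.d_ne_zero hc
    refine ⟨_, hasFDerivAt_map_affine hc z, ?_⟩
    rw [abs_det_sandwich ha (inv_ne_zero hd)]
    have ha' := norm_ne_zero_iff.2 ha
    have hd' := norm_ne_zero_iff.2 hd
    simp only [C, rho, hc, if_true, norm_smul, norm_inv, norm_div, norm_pow, norm_norm]
    field_simp
  · have he := T.e_ne_zero hc
    have hw := w_ne_zero hc hz
    refine ⟨_, hasFDerivAt_map hc hz, ?_⟩
    rw [abs_det_sandwich (mul_ne_zero (neg_ne_zero.2 (inv_ne_zero hw)) hc)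
      (mul_ne_zero (inv_ne_zero he) (inv_ne_zero hw))]
    have hc' := norm_ne_zero_iff.2 hc
    have he' := norm_ne_zero_iff.2 he
    have hw' := norm_ne_zero_iff.2 hw
    simp only [C, rho, hc, if_false, norm_smul, norm_inv, norm_div, norm_pow, norm_norm, norm_mul,
      norm_neg, Quaternion.norm_star]
    field_simp

variable {Ξ Ω : Set ℍ[ℝ]}

theorem continuous_mapTo (hfin : Ξ ⊆ T.finiteSet) (hT : T.map '' Ξ = Ω) :
    Continuous (T.mapTo hT) := by
  refine Continuous.subtype_mk (continuous_iff_continuousAt.2 fun z => ?_) _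
  exact ((contDiffAt_map (hfin z.2) (n := 0)).continuousAt).comp continuous_subtype_val.continuousAt

theorem mapTo_bijective (hfin : Ξ ⊆ T.finiteSet) (hT : T.map '' Ξ = Ω) :
    Function.Bijective (T.mapTo hT) := by
  constructor
  · intro x y h
    exact Subtype.ext (injOn_map (hfin x.2) (hfin y.2) (congrArg Subtype.val h))
  · rintro ⟨ζ, hζ⟩
    obtain ⟨z, hz, rfl⟩ := hT.symm ▸ hζ
    exact ⟨⟨z, hz⟩, rfl⟩

theorem measurableEmbedding_mapTo (hΞ : IsOpen Ξ) (hfin : Ξ ⊆ T.finiteSet)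
    (hT : T.map '' Ξ = Ω) : MeasurableEmbedding (T.mapTo hT) := by
  have : StandardBorelSpace Ξ := hΞ.measurableSet.standardBorel
  exact (continuous_mapTo hfin hT).measurable.measurableEmbedding (mapTo_bijective hfin hT).1

/-- The multiplier of the operator `transfer`. -/
def multiplier (T : Mobius) (u v : ℍ[ℝ]) (z : ℍ[ℝ]) : ℍ[ℝ] :=
  Real.exp (inner ℝ (v - u) z) • T.C z

theorem transfer_eq (θ : ℝ) (u v : ℍ[ℝ]) (hT : T.map '' Ξ = Ω) (f : Ω → ℍ[ℝ]) :
    T.transfer θ u v hT f = fun z : Ξ => T.multiplier u v z * f (T.mapTo hT z) := by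
  funext z
  rw [transfer, thetaInner_eq, multiplier, smul_mul_assoc]

theorem multiplier_ne_zero (u v : ℍ[ℝ]) {z : ℍ[ℝ]} (hz : z ∈ T.finiteSet) :
    T.multiplier u v z ≠ 0 := smul_ne_zero (Real.exp_pos _).ne' (C_ne_zero hz)

theorem continuous_multiplier (u v : ℍ[ℝ]) (hfin : Ξ ⊆ T.finiteSet) :
    Continuous fun z : Ξ => T.multiplier u v z := by
  have hC : Continuous fun z : Ξ => T.C z := continuous_iff_continuousAt.2 fun z =>
    ((contDiffAt_C (hfin z.2) (n := 0)).continuousAt).comp continuous_subtype_val.continuousAt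
  unfold multiplier
  exact (by fun_prop : Continuous fun z : Ξ => Real.exp (inner ℝ (v - u) z.1)).smul hC

theorem vol_eq_map (θ : ℝ) (u v : ℍ[ℝ]) (hΞ : IsOpen Ξ) (hΩ : IsOpen Ω)
    (hfin : Ξ ⊆ T.finiteSet) (hT : T.map '' Ξ = Ω) :
    vol Ω = Measure.map (T.mapTo hT) ((weightedVol Ξ (T.gamma θ u v)).withDensity
      fun z => ENNReal.ofReal (‖T.multiplier u v z‖ ^ 2)) := by
  have heΩ := measurableEmbedding_val hΩ
  have hτ := measurableEmbedding_mapTo hΞ hfin hT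
  choose! L hL hdet using fun z (hz : z ∈ Ξ) => exists_hasFDerivAt_map (hfin hz)
  have hmeas : Measurable fun z : Ξ => ENNReal.ofReal (T.gamma θ u v z) :=
    ((continuousOn_gamma θ u v).mono hfin).domRestrict.measurable.ennreal_ofReal
  have hmeas' : Measurable fun z : Ξ => ENNReal.ofReal (‖T.multiplier u v z‖ ^ 2) :=
    ((continuous_multiplier u v hfin).norm.pow 2).measurable.ennreal_ofReal
  have hden : (weightedVol Ξ (T.gamma θ u v)).withDensity
      (fun z : Ξ => ENNReal.ofReal (‖T.multiplier u v z‖ ^ 2))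
      = (vol Ξ).withDensity fun z => ENNReal.ofReal |(L z).det| := by
    rw [weightedVol, ← withDensity_mul _ hmeas hmeas']
    congr 1
    funext z
    rw [Pi.mul_apply, ← ENNReal.ofReal_mul (gamma_pos θ u v (hfin z.2)).le, hdet z z.2]
    congr 1
    rw [gamma, thetaInner_eq, multiplier, norm_smul, Real.norm_of_nonneg (Real.exp_pos _).le,
      mul_pow, ← Real.exp_nat_mul, mul_mul_mul_comm, ← Real.exp_add]
    have : -2 * inner ℝ (v - u) z.1 + ((2 : ℕ) : ℝ) * inner ℝ (v - u) z.1 = 0 := by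
      push_cast; ring
    rw [this, Real.exp_zero, one_mul, mul_comm]
  -- Measures on the subtype are determined by their images in the quaternions, where the change of
  -- variables formula applies.
  rw [hden, ← heΩ.comap_map (vol Ω), ← heΩ.comap_map (Measure.map (T.mapTo hT) _)]
  congr 1
  rw [Measure.map_map measurable_subtype_coe hτ.measurable, vol,
    map_comap_subtype_coe hΩ.measurableSet]
  have h := map_withDensity_abs_det_fderiv_eq_addHaar volume hΞ.nullMeasurableSet
    (fun x hx => (hL x hx).hasFDerivWithinAt) (injOn_map.mono hfin)
  rw [hT] at h
  have hmap : Measurable T.map := by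
    unfold map
    fun_prop
  rw [← h, ← map_val_withDensity hΞ, Measure.map_map hmap measurable_subtype_coe]
  rfl

end Mobius

/-! ### The transfer operator between function spaces -/

namespace Mobius

variable {T : Mobius} {Ξ Ω : Set ℍ[ℝ]}

/-- The operator `transfer` as a right linear bijection of function spaces. -/
def transferEquiv (θ : ℝ) (u v : ℍ[ℝ]) (hfin : Ξ ⊆ T.finiteSet) (hT : T.map '' Ξ = Ω) :
    (Ω → ℍ[ℝ]) ≃ₗ[ℍ[ℝ]ᵐᵒᵖ] (Ξ → ℍ[ℝ]) :=
  LinearEquiv.ofBijective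
    { toFun := T.transfer θ u v hT
      map_add' := fun f g => by
        simp only [transfer_eq]
        funext z
        exact mul_add _ _ _
      map_smul' := fun q f => by
        simp only [transfer_eq]
        funext z
        exact (mul_assoc _ _ _).symm }
    (by
      have hb := mapTo_bijective hfin hT
      constructor
      · intro f g h
        funext ζ
        obtain ⟨z, rfl⟩ := hb.2 ζ
        have hz := congrFun h z
        simp only [LinearMap.coe_mk, AddHom.coe_mk, transfer_eq] at hz
        exact mul_left_cancel₀ (multiplier_ne_zero u v (hfin z.2)) hz
      · intro g
        refine ⟨fun ζ => (T.multiplier u v ((Equiv.ofBijective _ hb).symm ζ))⁻¹ *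
          g ((Equiv.ofBijective _ hb).symm ζ), ?_⟩
        simp only [LinearMap.coe_mk, AddHom.coe_mk, transfer_eq]
        funext z
        have : (Equiv.ofBijective _ hb).symm (T.mapTo hT z) = z :=
          (Equiv.ofBijective _ hb).symm_apply_apply z
        rw [this, mul_inv_cancel_left₀ (multiplier_ne_zero u v (hfin z.2))])

theorem transferEquiv_apply (θ : ℝ) (u v : ℍ[ℝ]) (hfin : Ξ ⊆ T.finiteSet) (hT : T.map '' Ξ = Ω)
    (f : Ω → ℍ[ℝ]) : transferEquiv θ u v hfin hT f = T.transfer θ u v hT f := rfl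

theorem transfer_mem_sqIntegrable_iff (θ : ℝ) (u v : ℍ[ℝ]) (hΞ : IsOpen Ξ) (hΩ : IsOpen Ω)
    (hfin : Ξ ⊆ T.finiteSet) (hT : T.map '' Ξ = Ω) (f : Ω → ℍ[ℝ]) :
    T.transfer θ u v hT f ∈ sqIntegrable (weightedVol Ξ (T.gamma θ u v)) ↔
      f ∈ sqIntegrable (vol Ω) := by
  rw [transfer_eq]
  exact memLp_pullback_iff (measurableEmbedding_mapTo hΞ hfin hT)
    (continuous_multiplier u v hfin).measurable (fun z => multiplier_ne_zero u v (hfin z.2))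
    (vol_eq_map θ u v hΞ hΩ hfin hT) f

theorem transfer_mem_bergman_iff (θ : ℝ) (u v : ℍ[ℝ]) (hΞ : IsOpen Ξ) (hΩ : IsOpen Ω)
    (hfin : Ξ ⊆ T.finiteSet) (hT : T.map '' Ξ = Ω) (f : Ω → ℍ[ℝ]) :
    T.transfer θ u v hT f ∈ bergman θ (fun _ => u) (weightedVol Ξ (T.gamma θ u v)) ↔
      f ∈ bergman θ (T.delta v) (vol Ω) :=
  and_congr (transfer_mem_regular_iff hΞ hΩ hfin hT f)
    (transfer_mem_sqIntegrable_iff θ u v hΞ hΩ hfin hT f)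

theorem qinner_transfer (θ : ℝ) (u v : ℍ[ℝ]) (hΞ : IsOpen Ξ) (hΩ : IsOpen Ω)
    (hfin : Ξ ⊆ T.finiteSet) (hT : T.map '' Ξ = Ω) (f g : Ω → ℍ[ℝ]) :
    qinner (weightedVol Ξ (T.gamma θ u v)) (T.transfer θ u v hT f) (T.transfer θ u v hT g)
      = qinner (vol Ω) f g := by
  rw [transfer_eq, transfer_eq]
  exact integral_pullback (measurableEmbedding_mapTo hΞ hfin hT)
    (continuous_multiplier u v hfin).measurable (vol_eq_map θ u v hΞ hΩ hfin hT) f g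

end Mobius

/-- A right linear bijection restricts to subspaces that correspond to each other. -/
def restrictEquiv {E F : Type*} [AddCommGroup E] [AddCommGroup F] [Module ℍ[ℝ]ᵐᵒᵖ E]
    [Module ℍ[ℝ]ᵐᵒᵖ F] (e : E ≃ₗ[ℍ[ℝ]ᵐᵒᵖ] F) (p : Submodule ℍ[ℝ]ᵐᵒᵖ E) (q : Submodule ℍ[ℝ]ᵐᵒᵖ F)
    (h : ∀ x, e x ∈ q ↔ x ∈ p) : p ≃ₗ[ℍ[ℝ]ᵐᵒᵖ] q :=
  e.ofSubmodules p q (by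
    ext y
    rw [Submodule.mem_map]
    constructor
    · rintro ⟨x, hx, rfl⟩
      exact (h x).2 hx
    · intro hy
      exact ⟨e.symm y, (h _).1 (by simpa using hy), by simp⟩)

/-! ### Quaternionic right Hilbert spaces -/

theorem abs_re_le_norm (x : ℍ[ℝ]) : |x.re| ≤ ‖x‖ := by
  simpa [Quaternion.inner_def] using abs_real_inner_le_norm x 1

namespace IsRightHilbert

variable {E F : Type*} [AddCommGroup E] [AddCommGroup F] [Module ℍ[ℝ]ᵐᵒᵖ E]
    [Module ℍ[ℝ]ᵐᵒᵖ F]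

theorem of_equiv {ipE : E → E → ℍ[ℝ]} {ipF : F → F → ℍ[ℝ]} (hF : IsRightHilbert ipF)
    (e : E ≃ₗ[ℍ[ℝ]ᵐᵒᵖ] F) (h : ∀ f g, ipF (e f) (e g) = ipE f g) : IsRightHilbert ipE where
  add_right f g k := by simp only [← h, map_add, hF.add_right]
  smul_right f g q := by simp only [← h, map_smul, hF.smul_right]
  conj_symm f g := by simp only [← h, hF.conj_symm]
  nonneg f := by simp only [← h, hF.nonneg]
  definite f hf := by
    rw [← h] at hf
    simpa using hF.definite _ hf
  complete s hs := by
    obtain ⟨f, hf⟩ := hF.complete (fun n => e (s n)) (by simpa only [← map_sub, h] using hs)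
    refine ⟨e.symm f, fun ε hε => ?_⟩
    obtain ⟨N, hN⟩ := hf ε hε
    refine ⟨N, fun n hn => ?_⟩
    have := hN n hn
    rwa [← e.apply_symm_apply f, ← map_sub, h] at this

theorem sub_left {ip : E → E → ℍ[ℝ]} (hE : IsRightHilbert ip) (f g h : E) :
    ip (f - g) h = ip f h - ip g h := by
  have h1 := hE.add_right h (f - g) g
  rw [sub_add_cancel] at h1
  rw [← hE.conj_symm h (f - g), ← hE.conj_symm h f, ← hE.conj_symm h g, ← star_sub, h1,
    add_sub_cancel_right]

theorem eq_of_ip_eq {ip : E → E → ℍ[ℝ]} (hE : IsRightHilbert ip) {f g : E}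
    (h : ∀ k, ip f k = ip g k) : f = g := by
  rw [← sub_eq_zero]
  refine hE.definite _ ?_
  rw [hE.sub_left, h, sub_self, Quaternion.re_zero]

/-- The Riesz representation theorem. -/
theorem riesz {ip : E → E → ℍ[ℝ]} (hE : IsRightHilbert ip) (φ : E →ₗ[ℍ[ℝ]ᵐᵒᵖ] ℍ[ℝ]) (k : ℝ)
    (hφ : ∀ f, ‖φ f‖ ≤ k * √(ip f f).re) : ∃ g, ∀ f, φ f = ip g f := by
  -- Real scalars act through right multiplication, and the real part of `ip` is a real Hilbert
  -- inner product. The classical Riesz theorem then represents the real part of `φ`.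
  let : Module ℝ E := Module.compHom E (algebraMap ℝ ℍ[ℝ]ᵐᵒᵖ)
  have hsm : ∀ (r : ℝ) (f : E), r • f = MulOpposite.op (r : ℍ[ℝ]) • f := fun _ _ => rfl
  have hadd_left : ∀ f g h, ip (f + g) h = ip f h + ip g h := by
    intro f g h
    rw [← hE.conj_symm h (f + g), hE.add_right, star_add, hE.conj_symm, hE.conj_symm]
  have hsmul_left : ∀ (r : ℝ) f g, ip (r • f) g = (r : ℍ[ℝ]) * ip f g := by
    intro r f g
    rw [← hE.conj_symm g, hsm, hE.smul_right, star_mul, hE.conj_symm, Quaternion.star_coe]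
  let core : InnerProductSpace.Core ℝ E :=
    { inner := fun f g => (ip f g).re
      conj_inner_symm := fun f g => by
        change (ip g f).re = (ip f g).re
        rw [← hE.conj_symm f g, Quaternion.re_star]
      re_inner_nonneg := fun f => hE.nonneg f
      add_left := fun f g h => by
        change (ip (f + g) h).re = (ip f h).re + (ip g h).re
        rw [hadd_left, Quaternion.re_add]
      smul_left := fun f g r => by
        change (ip (r • f) g).re = r * (ip f g).re
        rw [hsmul_left]
        simp
      definite := fun f hf => hE.definite f hf }
  let : NormedAddCommGroup E := core.toNormedAddCommGroup
  let : InnerProductSpace ℝ E := InnerProductSpace.ofCore core.toCore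
  have hnorm : ∀ f : E, ‖f‖ = √(ip f f).re := fun f => rfl
  have hinner : ∀ f g : E, inner ℝ f g = (ip f g).re := fun f g => rfl
  have : CompleteSpace E := by
    refine Metric.complete_of_cauchySeq_tendsto fun s hs => ?_
    rw [Metric.cauchySeq_iff] at hs
    simp only [dist_eq_norm, hnorm] at hs
    obtain ⟨f, hf⟩ := hE.complete s hs
    refine ⟨f, Metric.tendsto_atTop.2 ?_⟩
    simpa only [dist_eq_norm, hnorm] using hf
  let ψ : E →L[ℝ] ℝ := LinearMap.mkContinuous
    { toFun := fun f => (φ f).re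
      map_add' := fun f g => by simp
      map_smul' := fun r f => by simp [hsm, map_smul, mul_comm] } k (fun f => by
        refine le_trans ?_ (hφ f)
        exact abs_re_le_norm _)
  refine ⟨(InnerProductSpace.toDual ℝ E).symm ψ, fun f => ?_⟩
  set g := (InnerProductSpace.toDual ℝ E).symm ψ with hg
  have h1 : ∀ f, (φ f).re = (ip g f).re := by
    intro f
    have : inner ℝ g f = ψ f := InnerProductSpace.toDual_symm_apply
    rw [← hinner, this]
    rfl
  -- Right linearity allows testing on `f q`; the choices `q = 1, i, j, k` recover all four
  -- components from real parts.
  have h2 : ∀ q : ℍ[ℝ], (φ f * q).re = (ip g f * q).re := by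
    intro q
    have := h1 (MulOpposite.op q • f)
    rwa [map_smul, hE.smul_right] at this
  have e0 := h2 1
  have e1 := h2 qi
  have e2 := h2 qj
  have e3 := h2 qk
  simp at e0 e1 e2 e3
  ext <;> assumption

end IsRightHilbert

theorem IsBergmanKernel.eq {Ω : Set ℍ[ℝ]} {μ : Measure Ω} {A : Submodule ℍ[ℝ]ᵐᵒᵖ (Ω → ℍ[ℝ])}
    (hA : IsRightHilbert fun f g : A => qinner μ f.1 g.1) {K K' : Ω → Ω → ℍ[ℝ]}
    (hK : IsBergmanKernel μ A K) (hK' : IsBergmanKernel μ A K') : K = K' := by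
  funext z ζ
  have h := hA.eq_of_ip_eq (f := ⟨_, (hK z).1⟩) (g := ⟨_, (hK' z).1⟩) fun k => by
    rw [← (hK z).2 k k.2, ← (hK' z).2 k k.2]
  exact star_injective (congrFun (congrArg Subtype.val h) ζ)

theorem existsUnique_isBergmanKernel {Ω : Set ℍ[ℝ]} {μ : Measure Ω}
    {A : Submodule ℍ[ℝ]ᵐᵒᵖ (Ω → ℍ[ℝ])} (hA : IsRightHilbert fun f g : A => qinner μ f.1 g.1)
    (hev : ∀ z : Ω, ∃ k : ℝ, ∀ f ∈ A, ‖f z‖ ≤ k * √(qinner μ f f).re) :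
    ∃! K, IsBergmanKernel μ A K := by
  have h : ∀ z : Ω, ∃ g : A, ∀ f : A, f.1 z = qinner μ g.1 f.1 := by
    intro z
    obtain ⟨k, hk⟩ := hev z
    exact hA.riesz ((LinearMap.proj (R := ℍ[ℝ]ᵐᵒᵖ) (φ := fun _ : Ω => ℍ[ℝ]) z).comp A.subtype) k
      fun f => hk f.1 f.2
  choose g hg using h
  have hK : IsBergmanKernel μ A fun z ζ => star ((g z).1 ζ) := by
    intro z
    simp only [star_star]
    exact ⟨(g z).2, fun f hf => hg z ⟨f, hf⟩⟩
  exact ⟨_, hK, fun K' hK' => hK'.eq hA hK⟩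

/-! ### The mean value property -/

theorem integral_fderiv_eq_zero {W : ℍ[ℝ] → ℍ[ℝ]} (hW : ContDiff ℝ 1 W)
    (hc : HasCompactSupport W) (v : ℍ[ℝ]) : ∫ x, fderiv ℝ W x v = 0 := by
  have hi : Integrable (fun x => fderiv ℝ W x v) :=
    ((hW.continuous_fderiv one_ne_zero).clm_apply continuous_const).integrable_of_hasCompactSupport
      (hc.fderiv_apply ℝ v)
  have h := integral_bilinear_hasLineDerivAt_right_eq_neg_left_of_integrable
    (μ := (volume : Measure ℍ[ℝ])) (B := ContinuousLinearMap.lsmul ℝ ℝ)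
    (f := fun _ => (1 : ℝ)) (f' := fun _ => 0) (g := W) (g' := fun x => fderiv ℝ W x v) (v := v)
    (by simp) (by simpa using hi)
    (by simpa using hW.continuous.integrable_of_hasCompactSupport hc)
    (fun x _ => (hasFDerivAt_const (1 : ℝ) x).hasLineDerivAt v)
    (fun x _ => ((hW.differentiable one_ne_zero) x).hasFDerivAt.hasLineDerivAt v)
  simpa using h

/-- The linear map `x ↦ Im(x̄ e)`. -/
def imMul (e : ℍ[ℝ]) : ℍ[ℝ] →L[ℝ] ℍ[ℝ] :=
  (sandwich 1 e).comp conjL - (innerSL ℝ e).smulRight 1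

theorem imMul_apply (e x : ℍ[ℝ]) : imMul e x = star x * e - inner ℝ e x • 1 := by
  simp [imMul]

theorem imMul_self {e : ℍ[ℝ]} (he : ‖e‖ = 1) : imMul e e = 0 := by
  have h := self_mul_star_eq (star e)
  rw [star_star, Quaternion.norm_star, he] at h
  rw [imMul_apply, h, real_inner_self_eq_norm_sq, he, sub_self]

theorem norm_qi : ‖qi‖ = 1 := by
  rw [← sq_eq_sq₀ (norm_nonneg _) one_pos.le, sq, ← Quaternion.normSq_eq_norm_mul_self,
    Quaternion.normSq_def']
  simp

theorem norm_qj : ‖qj‖ = 1 := by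
  rw [← sq_eq_sq₀ (norm_nonneg _) one_pos.le, sq, ← Quaternion.normSq_eq_norm_mul_self,
    Quaternion.normSq_def']
  simp

theorem norm_qk : ‖qk‖ = 1 := by
  rw [← sq_eq_sq₀ (norm_nonneg _) one_pos.le, sq, ← Quaternion.normSq_eq_norm_mul_self,
    Quaternion.normSq_def']
  simp

/-- The sum is `Im(x̄ x) = 0`: these fields are tangent to the spheres, so a radial factor is not
differentiated. -/
theorem sum_inner_imMul (x : ℍ[ℝ]) : (inner ℝ x 1 : ℝ) • imMul 1 x + (inner ℝ x qi : ℝ) • imMul qi x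
    + (inner ℝ x qj : ℝ) • imMul qj x + (inner ℝ x qk : ℝ) • imMul qk x = 0 := by
  simp only [imMul_apply, Quaternion.inner_def]
  ext <;> simp <;> ring

/-- Since `Im(x̄ e) = x̄ e - ⟨e, x⟩`, the two parts sum to `x̄` times the Fueter sum and to the
expansion of `L x`. -/
theorem sum_imMul_mul (x : ℍ[ℝ]) (L : ℍ[ℝ] →L[ℝ] ℍ[ℝ]) :
    imMul 1 x * L 1 + imMul qi x * L qi + imMul qj x * L qj + imMul qk x * L qk
      = star x * fueter L - L x := by
  rw [map_eq_basis L x]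
  simp only [imMul_apply, Quaternion.inner_def, fueter]
  generalize L 1 = a
  generalize L qi = b
  generalize L qj = c
  generalize L qk = d
  ext <;> simp <;> ring

section Radial

variable {G : ℝ → ℝ} {R : ℝ}

theorem contDiff_radial (hG : ContDiff ℝ 1 G) : ContDiff ℝ 1 fun x : ℍ[ℝ] => G (‖x‖ ^ 2) :=
  hG.comp (contDiff_norm_sq ℝ)

theorem hasCompactSupport_radial (h0 : ∀ x : ℍ[ℝ], R ≤ ‖x‖ → G (‖x‖ ^ 2) = 0) :
    HasCompactSupport fun x : ℍ[ℝ] => G (‖x‖ ^ 2) := by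
  refine HasCompactSupport.intro (isCompact_closedBall (0 : ℍ[ℝ]) R) fun x hx => h0 x ?_
  rw [mem_closedBall_zero_iff, not_le] at hx
  exact hx.le

/-- Summing over the basis, the divergence of the fields `G(‖x‖²) Im(x̄ e) g` equals `-G(‖x‖²)`
times the radial derivative of `g`, and compact support makes its integral zero. Only one derivative
of `g` is needed. -/
theorem integral_radial_smul_fderiv (hG : ContDiff ℝ 1 G)
    (h0 : ∀ x : ℍ[ℝ], R ≤ ‖x‖ → G (‖x‖ ^ 2) = 0) {g : ℍ[ℝ] → ℍ[ℝ]} (hg : ContDiff ℝ 1 g)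
    (hD : ∀ x, ‖x‖ < R → fueter (fderiv ℝ g x) = 0) :
    ∫ x, G (‖x‖ ^ 2) • fderiv ℝ g x x = 0 := by
  set W : ℍ[ℝ] → ℍ[ℝ] → ℍ[ℝ] := fun e x => G (‖x‖ ^ 2) • (imMul e x * g x) with hWdef
  have hW : ∀ e, ContDiff ℝ 1 (W e) := fun e =>
    (contDiff_radial hG).smul ((imMul e).contDiff.mul hg)
  have hWc : ∀ e, HasCompactSupport (W e) := fun e => (hasCompactSupport_radial h0).smul_right
  have hi : ∀ e, Integrable (fun x => fderiv ℝ (W e) x e) := fun e =>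
    (((hW e).continuous_fderiv one_ne_zero).clm_apply
      continuous_const).integrable_of_hasCompactSupport ((hWc e).fderiv_apply ℝ e)
  have hder : ∀ e, ‖e‖ = 1 → ∀ x, fderiv ℝ (W e) x e
      = (2 * deriv G (‖x‖ ^ 2)) • ((inner ℝ x e : ℝ) • imMul e x * g x)
        + G (‖x‖ ^ 2) • (imMul e x * fderiv ℝ g x e) := by
    intro e he x
    have h1 : HasFDerivAt (fun y : ℍ[ℝ] => G (‖y‖ ^ 2))
        (deriv G (‖x‖ ^ 2) • (2 : ℕ) • innerSL ℝ x) x :=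
      (hG.differentiable one_ne_zero _).hasDerivAt.comp_hasFDerivAt x
        (hasStrictFDerivAt_norm_sq x).hasFDerivAt
    have h2 := (imMul e).hasFDerivAt (x := x) |>.mul' (hg.differentiable one_ne_zero x).hasFDerivAt
    have h3 : fderiv ℝ (W e) x = _ := (h1.smul h2).fderiv
    rw [h3]
    simp [imMul_self he, smul_smul]
    rw [add_comm]
    congr 2
    ring
  have hsum : ∀ x, G (‖x‖ ^ 2) • fderiv ℝ g x x
      = -(fderiv ℝ (W 1) x 1 + fderiv ℝ (W qi) x qi + fderiv ℝ (W qj) x qj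
        + fderiv ℝ (W qk) x qk) := by
    intro x
    rw [hder 1 (by simp) x, hder qi norm_qi x, hder qj norm_qj x, hder qk norm_qk x]
    have e1 : ∀ (r s : ℝ) (a b c d a' b' c' d' : ℍ[ℝ]), (r • a + s • a') + (r • b + s • b')
        + (r • c + s • c') + (r • d + s • d') = r • (a + b + c + d) + s • (a' + b' + c' + d') := by
      intros; module
    rw [e1, ← add_mul, ← add_mul, ← add_mul, sum_inner_imMul, zero_mul, smul_zero, zero_add,
      sum_imMul_mul]
    by_cases hx : ‖x‖ < R
    · rw [hD x hx, mul_zero, zero_sub, smul_neg, neg_neg]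
    · rw [h0 x (not_lt.1 hx)]
      simp
  simp only [hsum]
  have i2 : Integrable (fun x => fderiv ℝ (W 1) x 1 + fderiv ℝ (W qi) x qi) :=
    (hi 1).add (hi qi)
  have i3 : Integrable (fun x => fderiv ℝ (W 1) x 1 + fderiv ℝ (W qi) x qi
      + fderiv ℝ (W qj) x qj) := i2.add (hi qj)
  rw [integral_neg, integral_add i3 (hi qk), integral_add i2 (hi qj), integral_add (hi 1) (hi qi)]
  simp only [integral_fderiv_eq_zero (hW _) (hWc _)]
  simp

theorem hasDerivAt_integral_dilation (hG : ContDiff ℝ 1 G)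
    (h0 : ∀ x : ℍ[ℝ], R ≤ ‖x‖ → G (‖x‖ ^ 2) = 0) {H : ℍ[ℝ] → ℍ[ℝ]} (hH : ContDiff ℝ 1 H)
    (z : ℍ[ℝ]) (ε : ℝ) :
    HasDerivAt (fun ε : ℝ => ∫ x, G (‖x‖ ^ 2) • H (z + ε • x))
      (∫ x, G (‖x‖ ^ 2) • fderiv ℝ H (z + ε • x) x) ε := by
  have hφc := hasCompactSupport_radial h0
  have hφ := (contDiff_radial hG).continuous
  have hcont : Continuous fun p : ℝ × ℍ[ℝ] => G (‖p.2‖ ^ 2) • fderiv ℝ H (z + p.1 • p.2) p.2 :=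
    (hφ.comp continuous_snd).smul (((hH.continuous_fderiv one_ne_zero).comp
      (continuous_const.add (continuous_fst.smul continuous_snd))).clm_apply continuous_snd)
  -- With the parameter within distance one of `ε` and `x` in the ball of radius `R`, compactness
  -- bounds the differentiated integrand; outside that ball it vanishes.
  obtain ⟨B, hB⟩ := ((isCompact_closedBall ε 1).prod
    (isCompact_closedBall (0 : ℍ[ℝ]) R)).exists_bound_of_continuousOn hcont.continuousOn
  have hcont' : ∀ ε : ℝ, Continuous fun x => G (‖x‖ ^ 2) • H (z + ε • x) := fun ε =>
    hφ.smul (hH.continuous.comp (continuous_const.add (continuous_id.const_smul ε)))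
  have hint : Integrable (fun x => G (‖x‖ ^ 2) • H (z + ε • x)) :=
    (hcont' ε).integrable_of_hasCompactSupport hφc.smul_right
  have hbound : Integrable ((Metric.closedBall (0 : ℍ[ℝ]) R).indicator fun _ => B) :=
    (integrable_indicator_iff measurableSet_closedBall).2
      (integrableOn_const measure_closedBall_lt_top.ne)
  have hdom : ∀ x : ℍ[ℝ], ∀ ε' ∈ Metric.ball ε 1, ‖G (‖x‖ ^ 2) • fderiv ℝ H (z + ε' • x) x‖
      ≤ (Metric.closedBall (0 : ℍ[ℝ]) R).indicator (fun _ => B) x := by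
    intro x ε' hε'
    by_cases hx : x ∈ Metric.closedBall (0 : ℍ[ℝ]) R
    · rw [Set.indicator_of_mem hx]
      exact hB (ε', x) ⟨Metric.ball_subset_closedBall hε', hx⟩
    · rw [Set.indicator_of_notMem hx]
      rw [mem_closedBall_zero_iff, not_le] at hx
      rw [h0 x hx.le, zero_smul, norm_zero]
  have hder : ∀ x : ℍ[ℝ], ∀ ε' ∈ Metric.ball ε 1,
      HasDerivAt (fun t : ℝ => G (‖x‖ ^ 2) • H (z + t • x))
        (G (‖x‖ ^ 2) • fderiv ℝ H (z + ε' • x) x) ε' := by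
    intro x ε' _
    have h1 : HasDerivAt (fun t : ℝ => z + t • x) x ε' := by
      have := ((hasDerivAt_id ε').smul_const x).const_add z
      rwa [one_smul] at this
    exact (((hH.differentiable one_ne_zero (z + ε' • x)).hasFDerivAt).comp_hasDerivAt ε'
      h1).const_smul (G (‖x‖ ^ 2))
  have hmeas : AEStronglyMeasurable (fun x => G (‖x‖ ^ 2) • fderiv ℝ H (z + ε • x) x) :=
    (hcont.comp (continuous_const.prodMk continuous_id)).aestronglyMeasurable
  exact (hasDerivAt_integral_of_dominated_loc_of_deriv_le (Metric.ball_mem_nhds ε one_pos)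
    (Filter.Eventually.of_forall fun ε' => (hcont' ε').aestronglyMeasurable) hint hmeas
    (Filter.Eventually.of_forall hdom) hbound (Filter.Eventually.of_forall hder)).2

/-- The mean value property of solutions of the Fueter equation. -/
theorem integral_radial_smul (hG : ContDiff ℝ 1 G)
    (h0 : ∀ x : ℍ[ℝ], R ≤ ‖x‖ → G (‖x‖ ^ 2) = 0) {H : ℍ[ℝ] → ℍ[ℝ]} (hH : ContDiff ℝ 1 H)
    {z : ℍ[ℝ]} (hD : ∀ x ∈ Metric.closedBall z R, fueter (fderiv ℝ H x) = 0) :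
    ∫ x, G (‖x‖ ^ 2) • H (z + x) = (∫ x : ℍ[ℝ], G (‖x‖ ^ 2)) • H z := by
  rcases le_or_gt R 0 with hR | hR
  · have : ∀ x : ℍ[ℝ], G (‖x‖ ^ 2) = 0 := fun x => h0 x (hR.trans (norm_nonneg x))
    simp [this]
  set I : ℝ → ℍ[ℝ] := fun ε => ∫ x, G (‖x‖ ^ 2) • H (z + ε • x) with hI
  have hderiv := hasDerivAt_integral_dilation hG h0 hH z
  have hzero : ∀ ε ∈ Set.Icc (0 : ℝ) 1,
      ∫ x, G (‖x‖ ^ 2) • fderiv ℝ H (z + ε • x) x = 0 := by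
    intro ε hε
    rcases eq_or_ne ε 0 with rfl | hε0
    -- At `ε = 0` the dilated function is constant and cannot be used. The linear map `fderiv ℝ H z`
    -- is itself regular and is its own radial derivative.
    · have := integral_radial_smul_fderiv hG h0 (g := fderiv ℝ H z) (fderiv ℝ H z).contDiff
        (fun x _ => by
          rw [ContinuousLinearMap.fderiv]
          exact hD z (Metric.mem_closedBall_self hR.le))
      simpa using this
    · have hder : ∀ x, fderiv ℝ (fun y => H (z + ε • y)) x = ε • fderiv ℝ H (z + ε • x) := by
        intro x
        have h1 : HasFDerivAt (fun y : ℍ[ℝ] => z + ε • y) (ε • ContinuousLinearMap.id ℝ ℍ[ℝ]) x :=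
          ((hasFDerivAt_id x).const_smul ε).const_add z
        have h2 := ((hH.differentiable one_ne_zero (z + ε • x)).hasFDerivAt).comp x h1
        refine h2.fderiv.trans (ContinuousLinearMap.ext fun y => ?_)
        simp
      have := integral_radial_smul_fderiv hG h0 (g := fun y => H (z + ε • y))
        (hH.comp (by fun_prop)) (fun x hx => by
          rw [hder, fueter_smul, hD, smul_zero]
          rw [mem_closedBall_iff_norm, add_sub_cancel_left, norm_smul, Real.norm_of_nonneg hε.1]
          exact (mul_le_of_le_one_left (norm_nonneg x) hε.2).trans hx.le)
      simp only [hder, smul_apply, smul_comm _ ε] at this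
      rw [integral_smul] at this
      exact (smul_eq_zero.1 this).resolve_left hε0
  have hconst := constant_of_has_deriv_right_zero (f := I) (a := 0) (b := 1)
    (fun ε _ => (hderiv ε).continuousAt.continuousWithinAt)
    (fun ε hε => by
      have h := hderiv ε
      rw [hzero ε ⟨hε.1, hε.2.le⟩] at h
      exact h.hasDerivWithinAt) 1 ⟨zero_le_one, le_rfl⟩
  simp only [hI, one_smul, zero_smul, add_zero] at hconst
  rw [hconst, integral_smul_const]

end Radial

/-! ### Square integrable functions -/

section L2

variable {Ω : Set ℍ[ℝ]} {μ : Measure Ω}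

theorem integrable_star_mul {f g : Ω → ℍ[ℝ]} (hf : MemLp f 2 μ) (hg : MemLp g 2 μ) :
    Integrable (fun z => star (f z) * g z) μ := hf.star.integrable_mul hg

theorem qinner_add_right {f g h : Ω → ℍ[ℝ]} (hf : MemLp f 2 μ) (hg : MemLp g 2 μ)
    (hh : MemLp h 2 μ) : qinner μ f (g + h) = qinner μ f g + qinner μ f h := by
  simp only [qinner, Pi.add_apply, mul_add]
  exact integral_add (integrable_star_mul hf hg) (integrable_star_mul hf hh)

theorem qinner_smul_right (f g : Ω → ℍ[ℝ]) (q : ℍ[ℝ]) :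
    qinner μ f (MulOpposite.op q • g) = qinner μ f g * q := by
  simp only [qinner, Pi.smul_apply, MulOpposite.smul_eq_mul_unop, MulOpposite.unop_op, ← mul_assoc]
  by_cases hq : q = 0
  · simp [hq]
  by_cases h : Integrable (fun z => star (f z) * g z) μ
  · exact integral_mul_const_of_integrable h
  -- Multiplication by a nonzero quaternion preserves non-integrability, so both integrals take the
  -- default value zero.
  · rw [integral_undef h, integral_undef, zero_mul]
    intro h'
    have := h'.mul_const q⁻¹
    simp only [mul_inv_cancel_right₀ hq] at this
    exact h this

theorem qinner_smul_left (f g : Ω → ℍ[ℝ]) (q : ℍ[ℝ]) :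
    qinner μ (MulOpposite.op q • f) g = star q * qinner μ f g := by
  simp only [qinner, Pi.smul_apply, MulOpposite.smul_eq_mul_unop, MulOpposite.unop_op, star_mul,
    mul_assoc]
  by_cases hq : q = 0
  · simp [hq]
  by_cases h : Integrable (fun z => star (f z) * g z) μ
  · exact integral_const_mul_of_integrable h
  · rw [integral_undef h, integral_undef, mul_zero]
    intro h'
    have := h'.const_mul (star q)⁻¹
    simp only [inv_mul_cancel_left₀ (star_ne_zero.2 hq)] at this
    exact h this

theorem star_qinner (f g : Ω → ℍ[ℝ]) : star (qinner μ f g) = qinner μ g f := by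
  have h := conjL.integral_comp_comm' (K := 1) (μ := μ) (AddMonoidHomClass.isometry_of_norm conjL
    Quaternion.norm_star).antilipschitz fun z => star (f z) * g z
  simp only [conjL_apply, star_mul, star_star] at h
  exact h.symm

theorem qinner_self (f : Ω → ℍ[ℝ]) : (qinner μ f f).re = ∫ z, ‖f z‖ ^ 2 ∂μ := by
  have h : ∀ x : ℍ[ℝ], star x * x = (‖x‖ ^ 2) • (1 : ℍ[ℝ]) := fun x => by
    simpa using self_mul_star_eq (star x)
  simp only [qinner, h]
  rw [integral_smul_const]
  simp

theorem sqrt_qinner_self {f : Ω → ℍ[ℝ]} (hf : MemLp f 2 μ) :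
    √(qinner μ f f).re = (eLpNorm f 2 μ).toReal := by
  rw [qinner_self, hf.eLpNorm_eq_integral_rpow_norm two_ne_zero ENNReal.ofNat_ne_top,
    ENNReal.toReal_ofReal (by positivity), Real.sqrt_eq_rpow]
  norm_num

end L2

/-! ### Local averages -/

section Convolution

set_option maxSynthPendingDepth 3

variable {E' F' : Type*} [NormedAddCommGroup E'] [NormedSpace ℝ E'] [NormedAddCommGroup F']
  [NormedSpace ℝ F'] (L : E' →L[ℝ] ℍ[ℝ] →L[ℝ] F')

theorem exists_norm_bilin_le {φ : ℍ[ℝ] → E'} (hφ : Continuous φ) (hc : HasCompactSupport φ) :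
    ∃ C : ℝ, ∀ z t x, ‖L (φ (z - t)) x‖ ≤ C * ‖x‖ := by
  obtain ⟨C, hC⟩ := hc.exists_bound_of_continuous hφ
  refine ⟨‖L‖ * C, fun z t x => (L.le_opNorm₂ _ _).trans ?_⟩
  gcongr
  exact hC _

/-- Convolution with a bounded function is bounded on integrable functions. -/
theorem exists_enorm_convolution_le {φ : ℍ[ℝ] → E'} (hφ : Continuous φ)
    (hc : HasCompactSupport φ) : ∃ C : ℝ, ∀ (k : ℍ[ℝ] → ℍ[ℝ]) (z : ℍ[ℝ]),
      ‖convolution φ k L volume z‖ₑ ≤ ENNReal.ofReal C * eLpNorm k 1 volume := by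
  obtain ⟨C, hC⟩ := exists_norm_bilin_le L hφ hc
  refine ⟨C, fun k z => ?_⟩
  rw [convolution_eq_swap]
  refine (enorm_integral_le_lintegral_enorm _).trans ?_
  rw [← eLpNorm_one_eq_lintegral_enorm]
  exact eLpNorm_le_mul_eLpNorm_of_ae_le_mul (Filter.Eventually.of_forall fun t => hC z t (k t)) 1

/-- General values of `φ` serve both a bump function and its derivative. -/
theorem tendsto_convolution {φ : ℍ[ℝ] → E'} (hφ : Continuous φ) (hc : HasCompactSupport φ)
    {k : ℕ → ℍ[ℝ] → ℍ[ℝ]} {l : ℍ[ℝ] → ℍ[ℝ]} (hk : ∀ n, Integrable (k n)) (hl : Integrable l)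
    (h : Filter.Tendsto (fun n => eLpNorm (k n - l) 1 volume) Filter.atTop (nhds 0)) (z : ℍ[ℝ]) :
    Filter.Tendsto (fun n => convolution φ (k n) L volume z) Filter.atTop
      (nhds (convolution φ l L volume z)) := by
  obtain ⟨C, hC⟩ := exists_norm_bilin_le L hφ hc
  have hi : ∀ k : ℍ[ℝ] → ℍ[ℝ], Integrable k → Integrable (fun t => L (φ (z - t)) (k t)) :=
    fun k hk => (hc.convolutionExists_left L hφ hk.locallyIntegrable z).integrable_swap
  simp only [convolution_eq_swap]
  refine tendsto_integral_of_L1' _ (hi l hl).aestronglyMeasurable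
    (Filter.Eventually.of_forall fun n => hi _ (hk n)) ?_
  have h' := ENNReal.Tendsto.const_mul (a := ENNReal.ofReal C) h (Or.inr ENNReal.ofReal_ne_top)
  rw [mul_zero] at h'
  refine tendsto_of_tendsto_of_tendsto_of_le_of_le tendsto_const_nhds h' (fun _ => zero_le)
    fun n => ?_
  refine eLpNorm_le_mul_eLpNorm_of_ae_le_mul (Filter.Eventually.of_forall fun t => ?_) 1
  simp only [Pi.sub_apply, ← map_sub]
  exact hC z t _

end Convolution

/-! ### Local comparison with the weighted norm -/

section LocalPart

variable {Ξ : Set ℍ[ℝ]} {γ : ℍ[ℝ] → ℝ}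

theorem exists_restrict_ball_le (hΞ : IsOpen Ξ) (hγ : ContinuousOn γ Ξ)
    (hγ0 : ∀ z ∈ Ξ, 0 < γ z) {z₀ : ℍ[ℝ]} {r : ℝ} (hr : 0 ≤ r) (hB : Metric.closedBall z₀ r ⊆ Ξ) :
    ∃ a : ENNReal, a ≠ ⊤ ∧ volume.restrict (Metric.ball z₀ r)
      ≤ a • Measure.map Subtype.val (weightedVol Ξ γ) := by
  obtain ⟨x, hx, hmin⟩ := (isCompact_closedBall z₀ r).exists_isMinOn
    ⟨z₀, Metric.mem_closedBall_self hr⟩ (hγ.mono hB)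
  have hm : ENNReal.ofReal (γ x) ≠ 0 := by simpa using hγ0 x (hB hx)
  have hmap : Measure.map Subtype.val (weightedVol Ξ γ)
      = (volume.restrict Ξ).withDensity fun z => ENNReal.ofReal (γ z) :=
    map_val_withDensity hΞ fun z => ENNReal.ofReal (γ z)
  have key : ∀ s, MeasurableSet s → ENNReal.ofReal (γ x) * volume (s ∩ Metric.ball z₀ r)
      ≤ ∫⁻ z in s ∩ Ξ, ENNReal.ofReal (γ z) := by
    intro s hs
    rw [← setLIntegral_const]
    refine (setLIntegral_mono' (hs.inter measurableSet_ball) fun z hz => ?_).trans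
      (lintegral_mono_set (Set.inter_subset_inter_right s
        (Metric.ball_subset_closedBall.trans hB)))
    exact ENNReal.ofReal_le_ofReal (hmin (Metric.ball_subset_closedBall hz.2))
  -- The constant is the reciprocal of the minimum of the weight on the closed ball.
  refine ⟨(ENNReal.ofReal (γ x))⁻¹, ENNReal.inv_ne_top.2 hm, ?_⟩
  rw [hmap]
  refine Measure.le_iff.2 fun s hs => ?_
  rw [Measure.restrict_apply hs, Measure.smul_apply, withDensity_apply _ hs, smul_eq_mul,
    Measure.restrict_restrict hs, mul_comm, ← div_eq_mul_inv,
    ENNReal.le_div_iff_mul_le (Or.inl hm) (Or.inl ENNReal.ofReal_ne_top), mul_comm]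
  exact key s hs

theorem exists_eLpNorm_indicator_le (hΞ : IsOpen Ξ) (hγ : ContinuousOn γ Ξ)
    (hγ0 : ∀ z ∈ Ξ, 0 < γ z) {z₀ : ℍ[ℝ]} {r : ℝ} (hr : 0 ≤ r) (hB : Metric.closedBall z₀ r ⊆ Ξ) :
    ∃ K : ENNReal, K ≠ ⊤ ∧ ∀ f : Ξ → ℍ[ℝ], MemLp f 2 (weightedVol Ξ γ) →
      Integrable ((Metric.ball z₀ r).indicator (zeroExt f)) ∧
      eLpNorm ((Metric.ball z₀ r).indicator (zeroExt f)) 1 volume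
        ≤ K * eLpNorm f 2 (weightedVol Ξ γ) := by
  obtain ⟨a, ha_top, hle⟩ := exists_restrict_ball_le hΞ hγ hγ0 hr hB
  have he := measurableEmbedding_val hΞ
  have hcomp : ∀ f : Ξ → ℍ[ℝ], zeroExt f ∘ Subtype.val = f := fun f => funext (zeroExt_apply f)
  set K₁ : ENNReal :=
    volume (Metric.ball z₀ r) ^ (1 / (1 : ENNReal).toReal - 1 / (2 : ENNReal).toReal) with hK₁
  set K₂ : ENNReal := a ^ (1 / (2 : ENNReal)).toReal with hK₂
  have h1 : K₁ ≠ ⊤ := ENNReal.rpow_ne_top_of_nonneg (by norm_num) measure_ball_lt_top.ne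
  have h2 : K₂ ≠ ⊤ := ENNReal.rpow_ne_top_of_nonneg ENNReal.toReal_nonneg ha_top
  refine ⟨K₁ * K₂, ENNReal.mul_ne_top h1 h2, fun f hf => ?_⟩
  have hmeas : AEStronglyMeasurable (zeroExt f) (volume.restrict (Metric.ball z₀ r)) := by
    refine AEStronglyMeasurable.mono_measure ?_ hle
    refine AEStronglyMeasurable.smul_measure ?_ a
    rw [he.aestronglyMeasurable_map_iff, hcomp]
    exact hf.1
  have hbd : eLpNorm ((Metric.ball z₀ r).indicator (zeroExt f)) 1 volume
      ≤ K₁ * K₂ * eLpNorm f 2 (weightedVol Ξ γ) := by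
    rw [eLpNorm_indicator_eq_eLpNorm_restrict measurableSet_ball]
    refine (eLpNorm_le_eLpNorm_mul_rpow_measure_univ one_le_two hmeas).trans ?_
    rw [Measure.restrict_apply_univ, ← hK₁, mul_comm, mul_assoc]
    refine mul_le_mul_right ((eLpNorm_mono_measure _ hle).trans ?_) _
    rw [eLpNorm_smul_measure_of_ne_top ENNReal.ofNat_ne_top, he.eLpNorm_map_measure, hcomp,
      smul_eq_mul]
  refine ⟨?_, hbd⟩
  rw [← memLp_one_iff_integrable]
  exact ⟨(aestronglyMeasurable_indicator_iff measurableSet_ball).2 hmeas,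
    hbd.trans_lt (ENNReal.mul_lt_top (ENNReal.mul_lt_top h1.lt_top h2.lt_top) hf.2)⟩

end LocalPart

/-! ### Radial reproduction and the weighted Fueter space -/

section Base

set_option maxSynthPendingDepth 3

/-- A smooth radial bump function supported in the ball of radius `R`. -/
def radialBump (R : ℝ) (x : ℍ[ℝ]) : ℝ := Real.smoothTransition (R ^ 2 - ‖x‖ ^ 2)

theorem contDiff_profile (R : ℝ) : ContDiff ℝ 1 fun t => Real.smoothTransition (R ^ 2 - t) :=
  Real.smoothTransition.contDiff.comp (by fun_prop)

theorem radialBump_eq_zero {R : ℝ} (hR : 0 < R) (x : ℍ[ℝ]) (hx : R ≤ ‖x‖) :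
    Real.smoothTransition (R ^ 2 - ‖x‖ ^ 2) = 0 :=
  Real.smoothTransition.zero_of_nonpos (sub_nonpos.2 (pow_le_pow_left₀ hR.le hx 2))

theorem contDiff_radialBump (R : ℝ) : ContDiff ℝ 1 (radialBump R) :=
  contDiff_radial (contDiff_profile R)

theorem hasCompactSupport_radialBump {R : ℝ} (hR : 0 < R) : HasCompactSupport (radialBump R) :=
  hasCompactSupport_radial (G := fun t => Real.smoothTransition (R ^ 2 - t))
    (radialBump_eq_zero hR)

theorem integral_radialBump_pos {R : ℝ} (hR : 0 < R) : 0 < ∫ x, radialBump R x := by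
  refine (contDiff_radialBump R).continuous.integral_pos_of_hasCompactSupport_nonneg_nonzero
    (x := 0) (hasCompactSupport_radialBump hR) (fun x => Real.smoothTransition.nonneg _) ?_
  simpa [radialBump] using (Real.smoothTransition.pos_of_pos (pow_pos hR 2)).ne'

/-- A cutoff makes the mean value property, which assumes a globally smooth function, available for
local solutions. -/
theorem exists_contDiff_eqOn {F : ℍ[ℝ] → ℍ[ℝ]} {z₀ : ℍ[ℝ]} {r s : ℝ} (hr : 0 < r) (hrs : r < s)
    (hF : ∀ z ∈ Metric.closedBall z₀ s, ContDiffAt ℝ 1 F z) :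
    ∃ H : ℍ[ℝ] → ℍ[ℝ], ContDiff ℝ 1 H ∧ ∀ z ∈ Metric.closedBall z₀ r, H z = F z := by
  let b : ContDiffBump z₀ := ⟨r, s, hr, hrs⟩
  refine ⟨fun z => b z • F z, contDiff_iff_contDiffAt.2 fun z => ?_, fun z hz => ?_⟩
  · by_cases hz : z ∈ Metric.closedBall z₀ s
    · exact b.contDiff.contDiffAt.smul (hF z hz)
    · have hz' : z ∉ tsupport b := by rwa [b.tsupport_eq]
      have h0 : (fun z => b z • F z) =ᶠ[nhds z] fun _ => 0 := by
        filter_upwards [(notMem_tsupport_iff_eventuallyEq.1 hz')] with y hy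
        simp [hy]
      exact contDiffAt_const.congr_of_eventuallyEq h0
  · simp only
    rw [b.one_of_mem_closedBall hz, one_smul]

variable {Ξ : Set ℍ[ℝ]} {γ : ℍ[ℝ] → ℝ} {θ : ℝ}

theorem convolution_radialBump {z₀ : ℍ[ℝ]} {R : ℝ} (hR : 0 < R)
    (hB : Metric.closedBall z₀ (3 * R) ⊆ Ξ) {f : Ξ → ℍ[ℝ]} (hf : f ∈ regular θ Ξ fun _ => 0)
    {z : ℍ[ℝ]} (hz : z ∈ Metric.ball z₀ R) :
    convolution (radialBump R) ((Metric.ball z₀ (2 * R)).indicator (zeroExt f))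
      (ContinuousLinearMap.lsmul ℝ ℝ) volume z = (∫ x, radialBump R x) • zeroExt f z := by
  rw [mem_regular] at hf
  -- Averages of radius `R` centred in the ball of radius `R` use points at distance less than `2R`
  -- from `z₀`. The shell up to `3R` leaves room for the cutoff.
  obtain ⟨H, hH, hHf⟩ := exists_contDiff_eqOn (r := 2 * R) (by positivity) (by linarith)
    fun z hz => (hf ⟨z, hB hz⟩).1
  have hsub : ∀ x : ℍ[ℝ], ‖x‖ ≤ R → z - x ∈ Metric.ball z₀ (2 * R) := by
    intro x hx
    rw [mem_ball_iff_norm] at hz ⊢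
    calc ‖z - x - z₀‖ = ‖(z - z₀) - x‖ := by congr 1; abel
      _ ≤ ‖z - z₀‖ + ‖x‖ := norm_sub_le _ _
      _ < 2 * R := by linarith
  have hD : ∀ x ∈ Metric.closedBall z R, fueter (fderiv ℝ H x) = 0 := by
    intro x hx
    have hx2 : x ∈ Metric.ball z₀ (2 * R) := by
      have := hsub (z - x) (by rwa [← dist_eq_norm, dist_comm])
      rwa [sub_sub_cancel] at this
    have hxΞ : x ∈ Ξ := hB (Metric.closedBall_subset_closedBall (by linarith)
      (Metric.ball_subset_closedBall hx2))
    have hev : H =ᶠ[nhds x] zeroExt f := by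
      filter_upwards [Metric.isOpen_ball.mem_nhds hx2] with y hy
      exact hHf y (Metric.ball_subset_closedBall hy)
    rw [hev.fderiv_eq]
    simpa using (hf ⟨x, hxΞ⟩).2
  have hmv := integral_radial_smul (contDiff_profile R) (radialBump_eq_zero hR) hH hD
  have hz2 : H z = zeroExt f z := hHf z (Metric.ball_subset_closedBall
    (Metric.ball_subset_ball (by linarith) hz))
  rw [hz2] at hmv
  refine Eq.trans ?_ hmv
  -- Convolution samples `z - x` and the mean value property `z + x`; the bump is even.
  rw [← integral_neg_eq_self, convolution]
  refine integral_congr_ae (Filter.Eventually.of_forall fun x => ?_)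
  simp only [ContinuousLinearMap.lsmul_apply, norm_neg, ← sub_eq_add_neg]
  by_cases hx : R ≤ ‖x‖
  · rw [radialBump_eq_zero hR x hx, radialBump, radialBump_eq_zero hR x hx, zero_smul, zero_smul]
  · have := hsub x (not_le.1 hx).le
    rw [Set.indicator_of_mem this, hHf _ (Metric.ball_subset_closedBall this)]
    rfl

/-- Evaluation functionals are bounded on the space of Fueter regular functions. -/
theorem exists_norm_apply_le (hΞ : IsOpen Ξ) (hγ : ContinuousOn γ Ξ) (hγ0 : ∀ z ∈ Ξ, 0 < γ z)
    (z : Ξ) : ∃ k : ℝ, ∀ f ∈ bergman θ (fun _ => 0) (weightedVol Ξ γ),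
      ‖f z‖ ≤ k * √(qinner (weightedVol Ξ γ) f f).re := by
  obtain ⟨ε, hε, hB⟩ := Metric.nhds_basis_closedBall.mem_iff.1 (hΞ.mem_nhds z.2)
  obtain ⟨R, hR, rfl⟩ : ∃ R, 0 < R ∧ ε = 3 * R := ⟨ε / 3, by positivity, by ring⟩
  obtain ⟨K, hK, hKf⟩ := exists_eLpNorm_indicator_le hΞ hγ hγ0 (r := 2 * R) (by positivity)
    ((Metric.closedBall_subset_closedBall (by linarith)).trans hB)
  obtain ⟨C, hC⟩ := exists_enorm_convolution_le (ContinuousLinearMap.lsmul ℝ ℝ)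
    (contDiff_radialBump R).continuous (hasCompactSupport_radialBump hR)
  have hc := integral_radialBump_pos hR
  refine ⟨(∫ x, radialBump R x)⁻¹ * ((ENNReal.ofReal C).toReal * K.toReal), fun f hf => ?_⟩
  have hf2 : MemLp f 2 (weightedVol Ξ γ) := hf.2
  have h1 := hC ((Metric.ball z.1 (2 * R)).indicator (zeroExt f)) z
  rw [convolution_radialBump hR hB hf.1 (Metric.mem_ball_self hR), zeroExt_apply] at h1
  have h2 := h1.trans (mul_le_mul_right (hKf f hf2).2 _)
  have h3 := ENNReal.toReal_mono (ENNReal.mul_ne_top ENNReal.ofReal_ne_top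
    (ENNReal.mul_ne_top hK hf2.2.ne)) h2
  rw [toReal_enorm, norm_smul, Real.norm_of_nonneg hc.le, ENNReal.toReal_mul, ENNReal.toReal_mul,
    ← sqrt_qinner_self hf2] at h3
  rw [mul_assoc, inv_mul_eq_div, le_div_iff₀ hc, mul_comm, mul_assoc]
  exact h3

/-- An `L²` limit of Fueter regular functions that converges pointwise is Fueter regular. -/
theorem mem_regular_of_tendsto (hΞ : IsOpen Ξ) (hγ : ContinuousOn γ Ξ) (hγ0 : ∀ z ∈ Ξ, 0 < γ z)
    {s : ℕ → Ξ → ℍ[ℝ]} {f : Ξ → ℍ[ℝ]}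
    (hs : ∀ n, s n ∈ bergman θ (fun _ => 0) (weightedVol Ξ γ)) (hf : MemLp f 2 (weightedVol Ξ γ))
    (hlim : Filter.Tendsto (fun n => eLpNorm (s n - f) 2 (weightedVol Ξ γ)) Filter.atTop (nhds 0))
    (hpt : ∀ z, Filter.Tendsto (fun n => s n z) Filter.atTop (nhds (f z))) :
    f ∈ regular θ Ξ fun _ => 0 := by
  rw [mem_regular]
  intro z₀
  obtain ⟨ε, hε, hB⟩ := Metric.nhds_basis_closedBall.mem_iff.1 (hΞ.mem_nhds z₀.2)
  obtain ⟨R, hR, rfl⟩ : ∃ R, 0 < R ∧ ε = 3 * R := ⟨ε / 3, by positivity, by ring⟩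
  obtain ⟨K, hK, hKf⟩ := exists_eLpNorm_indicator_le hΞ hγ hγ0 (r := 2 * R) (by positivity)
    ((Metric.closedBall_subset_closedBall (by linarith)).trans hB)
  have hs2 : ∀ n, MemLp (s n) 2 (weightedVol Ξ γ) := fun n => (hs n).2
  set c := ∫ x, radialBump R x with hc
  have hc0 : c ≠ 0 := (integral_radialBump_pos hR).ne'
  have hφ := contDiff_radialBump R
  have hφc := hasCompactSupport_radialBump hR
  set k : (Ξ → ℍ[ℝ]) → ℍ[ℝ] → ℍ[ℝ] :=
    fun g => (Metric.ball z₀.1 (2 * R)).indicator (zeroExt g) with hk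
  have hki : ∀ g, MemLp g 2 (weightedVol Ξ γ) → Integrable (k g) := fun g hg => (hKf g hg).1
  set N : (Ξ → ℍ[ℝ]) → ℍ[ℝ] → ℍ[ℝ] :=
    fun g => convolution (radialBump R) (k g) (ContinuousLinearMap.lsmul ℝ ℝ) volume with hN
  have hksub : ∀ n, k (s n) - k f = k (s n - f) := by
    intro n
    have : zeroExt (s n - f) = zeroExt (s n) - zeroExt f := by
      rw [eq_sub_iff_add_eq, ← zeroExt_add, sub_add_cancel]
    simp only [hk, this]
    exact (Set.indicator_sub _ _ _).symm
  have hk1 : Filter.Tendsto (fun n => eLpNorm (k (s n) - k f) 1 volume) Filter.atTop (nhds 0) := by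
    have h' := ENNReal.Tendsto.const_mul hlim (Or.inr hK)
    rw [mul_zero] at h'
    refine tendsto_of_tendsto_of_tendsto_of_le_of_le tendsto_const_nhds h' (fun _ => zero_le)
      fun n => ?_
    rw [hksub]
    exact (hKf _ ((hs2 n).sub hf)).2
  have hBΞ : Metric.ball z₀.1 R ⊆ Ξ := (Metric.ball_subset_closedBall.trans
    (Metric.closedBall_subset_closedBall (by linarith))).trans hB
  have hsN : ∀ n, ∀ z ∈ Metric.ball z₀.1 R, N (s n) z = c • zeroExt (s n) z := fun n z hz =>
    convolution_radialBump hR hB (hs n).1 hz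
  have hfN : ∀ z ∈ Metric.ball z₀.1 R, N f z = c • zeroExt f z := by
    intro z hz
    have h1 := tendsto_convolution (ContinuousLinearMap.lsmul ℝ ℝ) hφ.continuous hφc
      (fun n => hki _ (hs2 n)) (hki f hf) hk1 z
    have h2 : Filter.Tendsto (fun n => N (s n) z) Filter.atTop (nhds (c • zeroExt f z)) := by
      have : (fun n => N (s n) z) = fun n => c • s n ⟨z, hBΞ hz⟩ := by
        funext n
        rw [hsN n z hz, zeroExt_of_mem (s n) (hBΞ hz)]
      rw [this, zeroExt_of_mem f (hBΞ hz)]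
      exact (hpt _).const_smul c
    exact tendsto_nhds_unique h1 h2
  have hev : ∀ g, (∀ z ∈ Metric.ball z₀.1 R, N g z = c • zeroExt g z) →
      zeroExt g =ᶠ[nhds z₀.1] c⁻¹ • N g := by
    intro g hg
    filter_upwards [Metric.ball_mem_nhds z₀.1 hR] with z hz
    rw [Pi.smul_apply, hg z hz, smul_smul, inv_mul_cancel₀ hc0, one_smul]
  -- The derivative falls on the bump, so `L¹` convergence of the functions suffices for convergence
  -- of the derivatives.
  have hNd : ∀ g, MemLp g 2 (weightedVol Ξ γ) → HasFDerivAt (N g)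
      (convolution (fderiv ℝ (radialBump R)) (k g)
        ((ContinuousLinearMap.lsmul ℝ ℝ).precompL ℍ[ℝ]) volume z₀.1) z₀.1 := fun g hg =>
    hφc.hasFDerivAt_convolution_left _ hφ (hki g hg).locallyIntegrable z₀.1
  have hcont : ContDiff ℝ 1 (N f) :=
    hφc.contDiff_convolution_left (n := 1) _ hφ (hki f hf).locallyIntegrable
  refine ⟨(hcont.const_smul c⁻¹).contDiffAt.congr_of_eventuallyEq (hev f hfN), ?_⟩
  have hfd : ∀ g, MemLp g 2 (weightedVol Ξ γ) →
      (∀ z ∈ Metric.ball z₀.1 R, N g z = c • zeroExt g z) →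
      fderiv ℝ (zeroExt g) z₀ = c⁻¹ • fderiv ℝ (N g) z₀ := by
    intro g hg hgN
    rw [(hev g hgN).fderiv_eq]
    exact fderiv_const_smul (hNd g hg).differentiableAt c⁻¹
  have hzero : ∀ n, fueter (fderiv ℝ (N (s n)) z₀) = 0 := by
    intro n
    have h1 := ((mem_regular.1 (hs n).1) z₀).2
    rw [zero_mul, add_zero, hfd _ (hs2 n) (hsN n), fueter_smul] at h1
    exact (smul_eq_zero.1 h1).resolve_left (inv_ne_zero hc0)
  have hfcont : Continuous fueter := by
    unfold fueter
    fun_prop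
  have htend : Filter.Tendsto (fun n => fueter (fderiv ℝ (N (s n)) z₀)) Filter.atTop
      (nhds (fueter (fderiv ℝ (N f) z₀))) := by
    refine (hfcont.tendsto _).comp ?_
    simp only [(hNd f hf).fderiv, (hNd _ (hs2 _)).fderiv]
    exact tendsto_convolution _ (hφ.continuous_fderiv one_ne_zero) (hφc.fderiv ℝ)
      (fun n => hki _ (hs2 n)) (hki f hf) hk1 z₀.1
  simp only [hzero] at htend
  rw [hfd f hf hfN, fueter_smul, tendsto_nhds_unique htend tendsto_const_nhds]
  simp

theorem isRightHilbert_regular (hΞ : IsOpen Ξ) (hγ : ContinuousOn γ Ξ) (hγ0 : ∀ z ∈ Ξ, 0 < γ z) :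
    IsRightHilbert fun f g : bergman θ (fun _ => 0) (weightedVol Ξ γ) =>
      qinner (weightedVol Ξ γ) f.1 g.1 where
  add_right f g h := qinner_add_right f.2.2 g.2.2 h.2.2
  smul_right f g q := qinner_smul_right f.1 g.1 q
  conj_symm f g := star_qinner f.1 g.1
  nonneg f := by
    rw [qinner_self]
    exact integral_nonneg fun z => by positivity
  -- Elements are functions and not classes, so vanishing must hold at every point; the evaluation
  -- bound gives this.
  definite f hf := by
    ext1
    funext z
    obtain ⟨k, hk⟩ := exists_norm_apply_le (θ := θ) hΞ hγ hγ0 z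
    have := hk f.1 f.2
    rw [hf, Real.sqrt_zero, mul_zero] at this
    exact norm_le_zero_iff.1 this
  complete s hs := by
    have hm : ∀ n, MemLp (s n).1 2 (weightedVol Ξ γ) := fun n => (s n).2.2
    have hnorm : ∀ m n, √(qinner (weightedVol Ξ γ) (s m - s n).1 (s m - s n).1).re
        = (eLpNorm ((s m).1 - (s n).1) 2 (weightedVol Ξ γ)).toReal := fun m n =>
      sqrt_qinner_self ((hm m).sub (hm n))
    -- Bounded evaluations make the sequence Cauchy at each point, which provides the candidate
    -- limit.
    have hpt : ∀ z, ∃ y, Filter.Tendsto (fun n => (s n).1 z) Filter.atTop (nhds y) := by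
      intro z
      refine cauchySeq_tendsto_of_complete (Metric.cauchySeq_iff.2 fun ε hε => ?_)
      obtain ⟨k, hk⟩ := exists_norm_apply_le (θ := θ) hΞ hγ hγ0 z
      obtain ⟨M, hM⟩ := hs (ε / (|k| + 1)) (by positivity)
      refine ⟨M, fun m hm n hn => ?_⟩
      have h1 := hk _ (s m - s n).2
      have h2 := hM m hm n hn
      rw [lt_div_iff₀ (by positivity)] at h2
      rw [dist_eq_norm]
      refine lt_of_le_of_lt (h1.trans ?_) h2
      rw [mul_comm]
      gcongr
      linarith [le_abs_self k]
    choose f hf using hpt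
    have hfm : AEStronglyMeasurable f (weightedVol Ξ γ) :=
      aestronglyMeasurable_of_tendsto_ae Filter.atTop (fun n => (hm n).1)
        (Filter.Eventually.of_forall hf)
    have hle : ∀ ε > 0, ∃ M, ∀ n ≥ M,
        eLpNorm ((s n).1 - f) 2 (weightedVol Ξ γ) ≤ ENNReal.ofReal ε := by
      intro ε hε
      obtain ⟨M, hM⟩ := hs ε hε
      refine ⟨M, fun n hn => ?_⟩
      -- Fatou's lemma in the second index turns the Cauchy estimate into an estimate against the
      -- pointwise limit.
      refine (Lp.eLpNorm_lim_le_liminf_eLpNorm (f := fun m => (s n).1 - (s m).1)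
        (fun m => ((hm n).sub (hm m)).1) _
        (Filter.Eventually.of_forall fun z => (hf z).const_sub _)).trans ?_
      refine Filter.liminf_le_of_frequently_le' (Filter.Eventually.frequently ?_)
      filter_upwards [Filter.eventually_ge_atTop M] with m hm'
      have := hM n hn m hm'
      rw [hnorm] at this
      exact (ENNReal.le_ofReal_iff_toReal_le ((hm n).sub (hm m)).2.ne hε.le).2 this.le
    have hfL : MemLp f 2 (weightedVol Ξ γ) := by
      obtain ⟨M, hM⟩ := hle 1 one_pos
      have h1 : MemLp ((s M).1 - f) 2 (weightedVol Ξ γ) :=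
        ⟨(hm M).1.sub hfm, (hM M le_rfl).trans_lt ENNReal.ofReal_lt_top⟩
      simpa using (hm M).sub h1
    have hlim : Filter.Tendsto (fun n => eLpNorm ((s n).1 - f) 2 (weightedVol Ξ γ)) Filter.atTop
        (nhds 0) := by
      refine ENNReal.tendsto_atTop_zero.2 fun ε hε => ?_
      rcases eq_or_ne ε ⊤ with rfl | hε'
      · exact ⟨0, fun _ _ => le_top⟩
      · obtain ⟨M, hM⟩ := hle ε.toReal (ENNReal.toReal_pos hε.ne' hε')
        refine ⟨M, fun n hn => (hM n hn).trans ?_⟩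
        rw [ENNReal.ofReal_toReal hε']
    refine ⟨⟨f, mem_regular_of_tendsto hΞ hγ hγ0 (fun n => (s n).2) hfL hlim hf, hfL⟩,
      fun ε hε => ?_⟩
    obtain ⟨M, hM⟩ := hle (ε / 2) (by positivity)
    refine ⟨M, fun n hn => ?_⟩
    have h1 : √(qinner (weightedVol Ξ γ) ((s n).1 - f) ((s n).1 - f)).re = _ :=
      sqrt_qinner_self ((hm n).sub hfL)
    refine lt_of_eq_of_lt h1 ?_
    refine lt_of_le_of_lt (ENNReal.toReal_le_of_le_ofReal (by positivity) (hM n hn)) ?_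
    linarith

end Base

/-! ### Transport of kernels -/

theorem star_real_smul (r : ℝ) (x : ℍ[ℝ]) : star (r • x) = r • star x := map_smul conjL r x

variable {T : Mobius} {Ξ Ω : Set ℍ[ℝ]} {u v : ℍ[ℝ]}

/-- For fixed `z` the conjugated transported kernel is a right multiple of a transferred function,
so right linearity puts it in the target space. -/
theorem Mobius.star_kernel_eq (θ : ℝ) (hT : T.map '' Ξ = Ω) (K : Ω → Ω → ℍ[ℝ]) (z : Ξ) :
    (fun w : Ξ => star (T.multiplier u v z * K (T.mapTo hT z) (T.mapTo hT w)
      * star (T.multiplier u v w)))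
      = MulOpposite.op (star (T.multiplier u v z)) •
        T.transfer θ u v hT fun ζ => star (K (T.mapTo hT z) ζ) := by
  rw [Mobius.transfer_eq]
  funext w
  simp [star_mul, mul_assoc]

theorem IsBergmanKernel.transfer {θ : ℝ} (hΞ : IsOpen Ξ) (hΩ : IsOpen Ω)
    (hfin : Ξ ⊆ T.finiteSet) (hT : T.map '' Ξ = Ω) {K : Ω → Ω → ℍ[ℝ]}
    (hK : IsBergmanKernel (vol Ω) (bergman θ (T.delta v) (vol Ω)) K) :
    IsBergmanKernel (weightedVol Ξ (T.gamma θ u v))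
      (bergman θ (fun _ => u) (weightedVol Ξ (T.gamma θ u v)))
      fun z w => T.multiplier u v z * K (T.mapTo hT z) (T.mapTo hT w)
        * star (T.multiplier u v w) := by
  intro z
  obtain ⟨hK1, hK2⟩ := hK (T.mapTo hT z)
  rw [Mobius.star_kernel_eq θ]
  refine ⟨Submodule.smul_mem _ _
    ((Mobius.transfer_mem_bergman_iff θ u v hΞ hΩ hfin hT _).2 hK1), fun f hf => ?_⟩
  obtain ⟨g, rfl⟩ := (Mobius.transferEquiv θ u v hfin hT).surjective f
  rw [Mobius.transferEquiv_apply] at hf ⊢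
  rw [qinner_smul_left, Mobius.qinner_transfer θ u v hΞ hΩ hfin hT, star_star,
    ← hK2 g ((Mobius.transfer_mem_bergman_iff θ u v hΞ hΩ hfin hT g).1 hf), Mobius.transfer_eq]

end

end HyperBergman

/-! ### Assembly of the proposition -/

open HyperBergman in
theorem proposition3p12 (θ : ℝ) (hθ : θ ∈ Set.Ico 0 (2 * Real.pi)) (u v : ℍ[ℝ])
    (Ω Ξ : Set ℍ[ℝ]) (hΩo : IsOpen Ω) (hΩc : IsConnected Ω) (hΞo : IsOpen Ξ) (hΞc : IsConnected Ξ)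
    (T : Mobius) (hfin : Ξ ⊆ T.finiteSet) (hT : T.map '' Ξ = Ω) :
    let μ := vol Ω
    let ν := weightedVol Ξ (T.gamma θ u v)
    let AΩ := bergman θ (T.delta v) μ
    let AΞ := bergman θ (fun _ => u) ν
    -- both spaces are quaternionic right Hilbert spaces with bounded evaluations
    IsRightHilbert (fun f g : AΩ => qinner μ f.1 g.1) ∧
    IsRightHilbert (fun f g : AΞ => qinner ν f.1 g.1) ∧
    (∀ z : Ω, ∃ k : ℝ, ∀ f ∈ AΩ, ‖f z‖ ≤ k * √(qinner μ f f).re) ∧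
    (∀ z : Ξ, ∃ k : ℝ, ∀ f ∈ AΞ, ‖f z‖ ≤ k * √(qinner ν f f).re) ∧
    -- the operator restricts to an isometric isomorphism of the Bergman spaces
    (∃ S : AΩ ≃ₗ[ℍ[ℝ]ᵐᵒᵖ] AΞ, (∀ f, (S f).1 = T.transfer θ u v hT f.1) ∧
      ∀ f g, qinner ν (S f).1 (S g).1 = qinner μ f.1 g.1) ∧
    -- the Bergman kernels exist, are unique, and are related, as are the projections
    (∃! K, IsBergmanKernel μ AΩ K) ∧
    (∃! K, IsBergmanKernel ν AΞ K) ∧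
    ∃ V : sqIntegrable μ ≃ₗ[ℍ[ℝ]ᵐᵒᵖ] sqIntegrable ν,
      (∀ f, (V f).1 = T.transfer θ u v hT f.1) ∧
      ∀ KΩ KΞ, IsBergmanKernel μ AΩ KΩ → IsBergmanKernel ν AΞ KΞ →
        (∀ z w : Ξ, KΞ z w = Real.exp (thetaInner θ (v - u) (z + w)) •
          (T.C z * KΩ (T.mapTo hT z) (T.mapTo hT w) * star (T.C w))) ∧
        ∀ h : sqIntegrable ν, bergmanProjection ν KΞ h.1 =
          T.transfer θ u v hT (bergmanProjection μ KΩ (V.symm h).1) := by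
  intro μ ν AΩ AΞ
  -- The weight `γ_T` taken with `u = 0` belongs to the operator that lands in the solutions of `Df
  -- = 0`, where the analysis was done.
  have hBase := isRightHilbert_regular (θ := θ) hΞo
    ((Mobius.continuousOn_gamma θ 0 v).mono hfin) fun z hz => Mobius.gamma_pos θ 0 v (hfin hz)
  have evBase := exists_norm_apply_le (θ := θ) hΞo
    ((Mobius.continuousOn_gamma θ 0 v).mono hfin) fun z hz => Mobius.gamma_pos θ 0 v (hfin hz)
  let S (u : ℍ[ℝ]) := restrictEquiv (Mobius.transferEquiv θ u v hfin hT) AΩ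
    (bergman θ (fun _ => u) (weightedVol Ξ (T.gamma θ u v)))
    (Mobius.transfer_mem_bergman_iff θ u v hΞo hΩo hfin hT)
  have hq := fun u => Mobius.qinner_transfer θ u v hΞo hΩo hfin hT
  have hΩ : IsRightHilbert (fun f g : AΩ => qinner μ f.1 g.1) :=
    hBase.of_equiv (S 0) fun f g => hq 0 f.1 g.1
  -- The space with potential `u` is reached by passing to `Ω` with parameter `0` and back with
  -- parameter `u`.
  have hΞ : IsRightHilbert (fun f g : AΞ => qinner ν f.1 g.1) :=
    hΩ.of_equiv (S u).symm fun f g => by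
      rw [← hq u]
      have h : ∀ f, T.transfer θ u v hT ((S u).symm f).1 = f.1 := fun f =>
        congrArg Subtype.val ((S u).apply_symm_apply f)
      rw [h, h]
  have happ : ∀ u (f : Ω → ℍ[ℝ]) (z : Ξ),
      T.transfer θ u v hT f z = T.multiplier u v z * f (T.mapTo hT z) := fun u f z =>
    congrFun (Mobius.transfer_eq θ u v hT f) z
  have hbij := Mobius.mapTo_bijective hfin hT
  have evΩ : ∀ z : Ω, ∃ k : ℝ, ∀ f ∈ AΩ, ‖f z‖ ≤ k * √(qinner μ f f).re := by
    intro ζ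
    obtain ⟨z, rfl⟩ := hbij.2 ζ
    obtain ⟨k, hk⟩ := evBase z
    have hm := norm_pos_iff.2 (Mobius.multiplier_ne_zero 0 v (hfin z.2))
    refine ⟨‖T.multiplier 0 v z‖⁻¹ * k, fun f hf => ?_⟩
    have h := hk _ ((Mobius.transfer_mem_bergman_iff θ 0 v hΞo hΩo hfin hT f).2 hf)
    rw [happ, norm_mul, hq 0] at h
    rw [mul_assoc, inv_mul_eq_div, le_div_iff₀ hm, mul_comm]
    exact h
  have evΞ : ∀ z : Ξ, ∃ k : ℝ, ∀ f ∈ AΞ, ‖f z‖ ≤ k * √(qinner ν f f).re := by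
    intro z
    obtain ⟨k, hk⟩ := evΩ (T.mapTo hT z)
    refine ⟨‖T.multiplier u v z‖ * k, fun f hf => ?_⟩
    obtain ⟨g, rfl⟩ := (Mobius.transferEquiv θ u v hfin hT).surjective f
    rw [Mobius.transferEquiv_apply] at hf ⊢
    rw [hq u, happ, norm_mul, mul_assoc]
    exact mul_le_mul_of_nonneg_left
      (hk g ((Mobius.transfer_mem_bergman_iff θ u v hΞo hΩo hfin hT g).1 hf)) (norm_nonneg _)
  refine ⟨hΩ, hΞ, evΩ, evΞ, ⟨S u, fun _ => rfl, fun f g => hq u f.1 g.1⟩,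
    existsUnique_isBergmanKernel hΩ evΩ, existsUnique_isBergmanKernel hΞ evΞ,
    restrictEquiv (Mobius.transferEquiv θ u v hfin hT) (sqIntegrable μ) (sqIntegrable ν)
      (Mobius.transfer_mem_sqIntegrable_iff θ u v hΞo hΩo hfin hT), fun _ => rfl, ?_⟩
  intro KΩ KΞ hKΩ hKΞ
  have hK : KΞ = fun z w : Ξ => T.multiplier u v z * KΩ (T.mapTo hT z) (T.mapTo hT w)
      * star (T.multiplier u v w) :=
    hKΞ.eq hΞ (hKΩ.transfer hΞo hΩo hfin hT)
  refine ⟨fun z w => ?_, fun h => ?_⟩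
  · rw [hK, thetaInner_eq, inner_add_right, Real.exp_add]
    simp only [Mobius.multiplier, star_real_smul, smul_mul_assoc, mul_smul_comm, smul_smul,
      mul_assoc, mul_comm]
  · obtain ⟨f, rfl⟩ := (restrictEquiv (Mobius.transferEquiv θ u v hfin hT) (sqIntegrable μ)
      (sqIntegrable ν) (Mobius.transfer_mem_sqIntegrable_iff θ u v hΞo hΩo hfin hT)).surjective h
    rw [LinearEquiv.symm_apply_apply]
    funext z
    rw [happ]
    -- Written as an inner product with the conjugated kernel, the projection is carried over by the
    -- isometry. This uses only that `U` preserves `qinner`, so `h` need not be a solution.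
    have hp : ∀ {X : Set ℍ[ℝ]} (ρ : MeasureTheory.Measure X) (K : X → X → ℍ[ℝ]) (g : X → ℍ[ℝ]) z,
        bergmanProjection ρ K g z = qinner ρ (fun ζ => star (K z ζ)) g := by
      intro X ρ K g z
      simp only [bergmanProjection, qinner, star_star]
    rw [hp, hp, hK, Mobius.star_kernel_eq θ, qinner_smul_left, star_star]
    congr 1
    exact hq u _ f.1
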